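/- **Setting.** Positions are finite sequences of natural numbers ("tracks"; tracks $\ge 2$ are *argument tracks*). For a position $a$, $\overline a$ is obtained by replacing every argument track by $2$, and $\mathrm{ad}(a)$ is the number of argument tracks in $a$. Terms are the infinitary $\lambda$-terms (coinductive grammar $t::=x\mid\lambda x.t\mid t\,t$, seen as labelled trees with edge $0$ under $\lambda$ and $1,2$ under application) in which every infinite branch goes through edge $2$ infinitely often; a normal form is such a term without redex. Rigid types are given coinductively by $T::=\alpha\mid F\to T$, $F::=(T_k)_{k\in K}$ with $K\subseteq\mathbb N\setminus\{0,1\}$, and have no infinite branch ending in $1^\omega$ (in $F\to T$, $T$ sits on track $1$ and $T_k$ on track $k$). Contexts map variables to sequence types $F$. Rigid derivations are the possibly infinite trees of judgments $C\vdash t:T$ built from the rules: (ax) $x:k\cdot T\vdash x:T$ with an *axiom track* $k\ge2$; (abs) from $C\vdash t:T$ (at child $0$) infer $C-x\vdash\lambda x.t:C(x)\to T$; (app) from $C\vdash t:(S_k)_{k\in K}\to T$ (at child $1$) and $D_k\vdash u:S_k$ (at child $k$, $k\in K$), with disjoint contexts, infer $C\cup\bigcup_k D_k\vdash t\,u:T$.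 Let $A=\mathrm{supp}(P)$ be the set of positions of a derivation $P$ of $t$; the judgment at $a\in A$ is $C(a)\vdash t|_{\overline a}:T(a)$. For a set $A$ of positions, $\mathrm{Ax}(a)(x)$ is the set of $a'\in A$ extending $a$ such that $\overline{a'}$ is an occurrence of $x$ free in $t|_{\overline a}$. $P$ is *quantitative* if $C(a)(x)=\bigcup_{a'\in \mathrm{Ax}(a)(x)}\mathrm{tr}(a')\cdot T(a')$ for all $a,x$, where $\mathrm{tr}(a')$ is the axiom track at $a'$. **The trivial construction.** Let $t$ be a normal form. A *d-support* of $t$ is a non-empty set $A$ of positions with $\overline A\subseteq\mathrm{supp}(t)$ such that $a\in A$ whenever $\overline a\in\mathrm{supp}(t)$ and some common prefix $a_0$ of $a$ and of an element of $A$ satisfies $\mathrm{ad}(a)=\mathrm{ad}(a_0)$. For $a\in A$, if $t|_{\overline a}=\lambda x_1\dots x_n.u$ with $n\ge1$ and $u$ not an abstraction, put $\mathring a=a\cdot0^n$; otherwise let $\mathring a$ be the shortest position with $a=\mathring a\cdot1^n$ for some $n\ge0$. Full positions are those with $a=\mathring a$; $\mathring A$ is the set of full positions in $A$. Let $T$ assign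 a type to each full position of $A$, and let $\mathrm{tr}$ assign a track $\ge2$ to each axiom position of $A$, *admissibly*: injectively on every $\mathrm{Ax}(a)(x)$, $a\in A$ (for example the restriction of a fixed injection $a\mapsto\lfloor a\rfloor$ from positions to integers $\ge 2$). The trivial construction from $(A,\mathrm{tr},T)$ is the tree of support $A$ carrying $C(a)\vdash t|_{\overline a}:T(a)$ at $a\in A$, where $C(a)(x)=(\mathrm{tr}(a')\cdot T(a'))_{a'\in\mathrm{Ax}(a)(x)}$ and $T$ is extended coinductively from full positions to $A$ by $T(a)=C(a\cdot0)(x_1)\to\dots\to C(a\cdot0^n)(x_n)\to T(\mathring a)$ if $t|_{\overline a}=\lambda x_1\dots x_n.u$ as above, and $T(a)=F_1(a)\to\dots\to F_n(a)\to T(\mathring a)$ with $F_k(a)=(\ell\cdot T(\mathring a\cdot1^{n-k}\cdot\ell))_{\ell\ge2,\ \mathring a\cdot1^{n-k}\cdot\ell\in A}$ if $a=\mathring a\cdot1^n$. An isomorphism of derivations of the same term consists of a bijection of positions and, at every position, of bijections between the types and between the sequence types of each variable; all of them preserve labels, map children to children, fix tracks $0,1$ and map argument tracks to argument tracks, and they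 are compatible with the three rules. **Proposition.** Let $t$ be a normal form. 1. Let $P$ be a quantitative derivation typing $t$, $A=\mathrm{supp}(P)$, and let $T$ be the restriction to $\mathring A$ of the types in $P$. Then $A$ is a d-support of $t$; the axiom tracks of $P$ are admissible, and the trivial construction from $A$, these axiom tracks and $T$ yields $P$ itself. Moreover, for every injection $\lfloor\cdot\rfloor$ from positions to integers $\ge2$, the trivial construction from $A$, $\lfloor\cdot\rfloor$ and $T$ yields a derivation isomorphic to $P$. 2. Conversely, for every d-support $A$ of $t$, every admissible $\mathrm{tr}$ and every $T:\mathring A\to$ types, the trivial construction yields a quantitative derivation typing $t$, with support $A$ and with type $T(a)$ at each full position $a$. Hence the trivial constructions describe all quantitative derivations of normal forms. -/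

import Mathlib

namespace Rigid

/-! ## Positions and labelled trees -/

/-- A labelled tree (or forest) on finite sequences of natural numbers:
`none` means that the position is not in the support. -/
abbrev LTree (σ : Type*) := List ℕ → Option σ

/-- The support of a labelled tree. -/
def supp {σ : Type*} (T : LTree σ) : Set (List ℕ) := {a | T a ≠ none}

/-- The subtree at position `b`. -/
def subtree {σ : Type*} (T : LTree σ) (b : List ℕ) : LTree σ := fun c => T (b ++ c)

/-- The tree with a single node, labelled `s`. -/
def leaf {σ : Type*} (s : σ) : LTree σ
  | [] => some s
  | _ :: _ => none

/-- The applicative depth: the number of argument tracks (tracks `≥ 2`) in a position. -/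
def appDepth (a : List ℕ) : ℕ := a.countP (fun k => decide (2 ≤ k))

/-- The collapse: every argument track is replaced by `2`. -/
def collapse (a : List ℕ) : List ℕ := a.map (fun k => min k 2)

/-! ## Infinitary terms -/

inductive TermSym (V : Type*) where
  | var (x : V)
  | lam (x : V)
  | app

def termVar {V : Type*} (x : V) : LTree (TermSym V) := leaf (.var x)

def termLam {V : Type*} (x : V) (t : LTree (TermSym V)) : LTree (TermSym V)
  | [] => some (.lam x)
  | 0 :: b => t b
  | _ :: _ => none

def termApp {V : Type*} (t u : LTree (TermSym V)) : LTree (TermSym V)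
  | [] => some .app
  | 1 :: b => t b
  | 2 :: b => u b
  | _ :: _ => none

/-- Parsing trees of the coinductive grammar `t, u ::= x | λ x. t | t u`. -/
structure IsTerm {V : Type*} (t : LTree (TermSym V)) : Prop where
  root : t [] ≠ none
  outside : ∀ b k, t b = none → t (b ++ [k]) = none
  var : ∀ b x k, t b = some (.var x) → t (b ++ [k]) = none
  lam : ∀ b x k, t b = some (.lam x) → (t (b ++ [k]) ≠ none ↔ k = 0)
  app : ∀ b k, t b = some .app → (t (b ++ [k]) ≠ none ↔ k = 1 ∨ k = 2)

/-- 001-terms: every infinite branch visits application arguments infinitely often. -/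
structure Is001Term {V : Type*} (t : LTree (TermSym V)) : Prop extends IsTerm t where
  branch : ∀ f : ℕ → ℕ, (∀ n, (List.range n).map f ∈ supp t) → {i | 2 ≤ f i}.Infinite

/-- A normal form: no position carries a redex `(λ x. r) s`. -/
def IsNormalForm {V : Type*} (t : LTree (TermSym V)) : Prop :=
  ∀ b x, t b = some .app → t (b ++ [1]) ≠ some (.lam x)

/-! ## Rigid types, sequence types and contexts -/

inductive TySym (X : Type*) where
  | var (α : X)
  | arrow

def TySym.map {X Y : Type*} (f : X → Y) : TySym X → TySym Y
  | .var α => .var (f α)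
  | .arrow => .arrow

/-- A family of labelled trees indexed by tracks; `none` where the track is not a root. -/
abbrev Seq (X : Type*) := ℕ → Option (LTree (TySym X))

/-- The type `F → T`. -/
def arrow {X : Type*} (F : Seq X) (T : LTree (TySym X)) : LTree (TySym X)
  | [] => some .arrow
  | 0 :: _ => none
  | 1 :: c => T c
  | (k + 2) :: c => (F (k + 2)).bind (fun U => U c)

/-- The type `F₁ → F₂ → ⋯ → Fₙ → T`. -/
def arrows {X : Type*} (L : List (Seq X)) (T : LTree (TySym X)) : LTree (TySym X) :=
  L.foldr arrow T

/-- The set of rigid types: parsing trees of the coinductive grammar `T ::= α | F → T`,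
`F ::= (T_k)_{k ∈ K}` with `K ⊆ {2, 3, …}`, without infinite branch ending by `1 1 1 …`. -/
structure IsType {X : Type*} (T : LTree (TySym X)) : Prop where
  root : T [] ≠ none
  outside : ∀ c k, T c = none → T (c ++ [k]) = none
  var : ∀ c α k, T c = some (.var α) → T (c ++ [k]) = none
  arrow : ∀ c, T c = some .arrow → T (c ++ [0]) = none ∧ T (c ++ [1]) ≠ none
  branch : ∀ c, ∃ n, T (c ++ List.replicate n 1) = none

/-- Sequence types: the tracks are at least `2` and carry types. -/
def IsSeqType {X : Type*} (F : Seq X) : Prop := ∀ k T, F k = some T → 2 ≤ k ∧ IsType T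

/-- A sequence type as a labelled forest. -/
def Seq.forest {X : Type*} (F : Seq X) : LTree (TySym X)
  | [] => none
  | k :: c => (F k).bind (fun U => U c)

/-- The empty sequence type. -/
def Seq.empty {X : Type*} : Seq X := fun _ => none

abbrev Ctx (V X : Type*) := V → Seq X

open Classical in
/-- The context `x : k · T`. -/
noncomputable def Ctx.single {V X : Type*} (x : V) (k : ℕ) (T : LTree (TySym X)) : Ctx V X :=
  fun y i => if y = x ∧ i = k then some T else none

open Classical in
/-- The context `C - x`. -/
noncomputable def Ctx.erase {V X : Type*} (C : Ctx V X) (x : V) : Ctx V X :=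
  fun y => if y = x then Seq.empty else C y

/-! ## Rigid derivations -/

/-- A judgment `ctx ⊢ subj : ty`. -/
@[ext]
structure Judgment (V X : Type*) where
  ctx : Ctx V X
  subj : LTree (TermSym V)
  ty : LTree (TySym X)

structure Judgment.Valid {V X : Type*} (J : Judgment V X) : Prop where
  ctx : ∀ x, IsSeqType (J.ctx x)
  subj : Is001Term J.subj
  ty : IsType J.ty

/-- The judgment `x : k · T ⊢ x : T`. -/
noncomputable def Judgment.ax {V X : Type*} (x : V) (k : ℕ) (T : LTree (TySym X)) :
    Judgment V X :=
  ⟨Ctx.single x k T, termVar x, T⟩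

/-- The sequence of the types of the argument premises of the node `a`. -/
def argTypes {V X : Type*} (P : LTree (Judgment V X)) (a : List ℕ) : Seq X :=
  fun k => if 2 ≤ k then (P (a ++ [k])).map Judgment.ty else none

/-- The axiom rule is correctly applied at `a`. -/
def AxRule {V X : Type*} (P : LTree (Judgment V X)) (a : List ℕ) (J : Judgment V X) : Prop :=
  ∃ x k T, 2 ≤ k ∧ J = Judgment.ax x k T ∧ ∀ i, P (a ++ [i]) = none

/-- The abstraction rule is correctly applied at `a`; the premise is at `a · 0`. -/
def AbsRule {V X : Type*} (P : LTree (Judgment V X)) (a : List ℕ) (J : Judgment V X) : Prop :=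
  ∃ x J₀, P (a ++ [0]) = some J₀ ∧ (∀ i, i ≠ 0 → P (a ++ [i]) = none) ∧
    J = ⟨J₀.ctx.erase x, termLam x J₀.subj, arrow (J₀.ctx x) J₀.ty⟩

/-- The application rule is correctly applied at `a`: the left premise is at `a · 1`, the track
`k` premise is at `a · k`, the contexts of the premises are disjoint and their join is the
context of the conclusion. -/
def AppRule {V X : Type*} (P : LTree (Judgment V X)) (a : List ℕ) (J : Judgment V X) : Prop :=
  ∃ u J₁, P (a ++ [0]) = none ∧ P (a ++ [1]) = some J₁ ∧
    J.subj = termApp J₁.subj u ∧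
    (∀ k D, 2 ≤ k → P (a ++ [k]) = some D → D.subj = u) ∧
    J₁.ty = arrow (argTypes P a) J.ty ∧
    (∀ i j D D' x k, P (a ++ [i]) = some D → P (a ++ [j]) = some D' →
      D.ctx x k ≠ none → D'.ctx x k ≠ none → i = j) ∧
    (∀ x k T, J.ctx x k = some T ↔ ∃ i D, P (a ++ [i]) = some D ∧ D.ctx x k = some T)

/-- Rigid derivations, as labelled trees all of whose nodes are correct. -/
structure IsDerivation {V X : Type*} (P : LTree (Judgment V X)) : Prop where
  root : P [] ≠ none
  outside : ∀ a k, P a = none → P (a ++ [k]) = none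
  valid : ∀ a J, P a = some J → J.Valid
  rule : ∀ a J, P a = some J → AxRule P a J ∨ AbsRule P a J ∨ AppRule P a J

/-- `P` is a derivation whose conclusion is a typing of `t`. -/
def IsDerivationOf {V X : Type*} (t : LTree (TermSym V)) (P : LTree (Judgment V X)) : Prop :=
  IsDerivation P ∧ ∃ J, P [] = some J ∧ J.subj = t

/-- The positions of `A` above `a` that collapse to an occurrence of `x` that is free in the
subterm of `t` at (the collapse of) `a`. -/
def axPos {V : Type*} (t : LTree (TermSym V)) (A : Set (List ℕ)) (a : List ℕ) (x : V) :
    Set (List ℕ) :=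
  {a' | a' ∈ A ∧ a <+: a' ∧ t (collapse a') = some (.var x) ∧
    ∀ b, a <+: b → b <+: a' → t (collapse b) ≠ some (.lam x)}

/-- `P` (typing `t`) is quantitative: each `C(a)(x)` is the union of the `k · T` over the axioms
`x : k · T ⊢ x : T` of `P` that type a free occurrence of `x` above `a`. -/
def IsQuantitative {V X : Type*} (t : LTree (TermSym V)) (P : LTree (Judgment V X)) : Prop :=
  ∀ a J, P a = some J → ∀ x k T,
    (J.ctx x k = some T ↔ ∃ a' ∈ axPos t (supp P) a x, P a' = some (Judgment.ax x k T))

/-! ## Isomorphisms of derivations -/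

/-- A bijection between two trees (or forests, completed by the root) of positions that maps
children to children, fixes the tracks `0` and `1`, and maps argument tracks to argument
tracks. -/
structure IsTreeIso (A₁ A₂ : Set (List ℕ)) (φ : List ℕ → List ℕ) : Prop where
  root : φ [] = []
  bij : Set.BijOn φ A₁ A₂
  step : ∀ a k, a ++ [k] ∈ A₁ → ∃ k', φ (a ++ [k]) = φ a ++ [k'] ∧ min k' 2 = min k 2

/-- Label-preserving isomorphisms; used for types and for sequence types seen as forests. -/
structure IsLabelledIso {σ : Type*} (T₁ T₂ : LTree σ) (φ : List ℕ → List ℕ) : Prop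
    extends IsTreeIso (supp T₁) (supp T₂) φ where
  label : ∀ c, c ∈ supp T₁ → T₂ (φ c) = T₁ c

/-- `(φ, ψ, χ)` is an isomorphism from `P₁` to `P₂`: `φ` acts on positions, `ψ a` on the type at
`a`, `χ a x` on the sequence type of `x` at `a`, in a way compatible with the typing rules. -/
structure IsDerivationIso {V X : Type*} (P₁ P₂ : LTree (Judgment V X))
    (φ : List ℕ → List ℕ) (ψ : List ℕ → List ℕ → List ℕ)
    (χ : List ℕ → V → List ℕ → List ℕ) : Prop where
  pos : IsTreeIso (supp P₁) (supp P₂) φ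
  node : ∀ a J₁ J₂, P₁ a = some J₁ → P₂ (φ a) = some J₂ →
    J₁.subj = J₂.subj ∧ IsLabelledIso J₁.ty J₂.ty (ψ a) ∧
    ∀ x, IsLabelledIso (J₁.ctx x).forest (J₂.ctx x).forest (χ a x)
  ax : ∀ a x k T, P₁ a = some (Judgment.ax x k T) → ∀ c ∈ supp T,
    (χ a x (k :: c)).tail = ψ a c
  abs_head : ∀ a J x, P₁ a = some J → J.subj [] = some (.lam x) →
    ∀ c, 1 :: c ∈ supp J.ty → ψ a (1 :: c) = 1 :: ψ (a ++ [0]) c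
  abs_tail : ∀ a J x, P₁ a = some J → J.subj [] = some (.lam x) →
    ∀ k c, 2 ≤ k → k :: c ∈ supp J.ty → ψ a (k :: c) = χ (a ++ [0]) x (k :: c)
  abs_ctx : ∀ a J x, P₁ a = some J → J.subj [] = some (.lam x) →
    ∀ y, y ≠ x → ∀ d ∈ supp (J.ctx y).forest, χ a y d = χ (a ++ [0]) y d
  app_head : ∀ a J, P₁ a = some J → J.subj [] = some .app →
    ∀ c ∈ supp J.ty, ψ (a ++ [1]) (1 :: c) = 1 :: ψ a c
  app_tail : ∀ a J, P₁ a = some J → J.subj [] = some .app →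
    ∀ k D, 2 ≤ k → P₁ (a ++ [k]) = some D →
      ∃ k', φ (a ++ [k]) = φ a ++ [k'] ∧
        ∀ c ∈ supp D.ty, ψ (a ++ [1]) (k :: c) = k' :: ψ (a ++ [k]) c
  app_ctx : ∀ a J, P₁ a = some J → J.subj [] = some .app →
    ∀ i D, P₁ (a ++ [i]) = some D → ∀ x, ∀ d ∈ supp (D.ctx x).forest,
      χ a x d = χ (a ++ [i]) x d

/-- Isomorphic derivations. -/
def Isomorphic {V X : Type*} (P₁ P₂ : LTree (Judgment V X)) : Prop :=
  ∃ φ ψ χ, IsDerivationIso P₁ P₂ φ ψ χ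

/-! ## Positions in a normal form -/

/-- The applicative priority `a ≺ a'`. -/
def Prior (a a' : List ℕ) : Prop :=
  ∃ a₀, a₀ <+: a ∧ a₀ <+: a' ∧ appDepth a = appDepth a₀ ∧ appDepth a₀ ≤ appDepth a'

/-- Derivation supports of `t`: non-empty sets of positions that collapse into `supp t`, downward
closed for `≺` among such positions. -/
structure IsDSupport {V : Type*} (t : LTree (TermSym V)) (A : Set (List ℕ)) : Prop where
  nonempty : A.Nonempty
  sub : ∀ a ∈ A, collapse a ∈ supp t
  down : ∀ a a', a' ∈ A → collapse a ∈ supp t → Prior a a' → a ∈ A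

/-- The subterm at (the collapse of) `a` is an abstraction. -/
def IsAbsPos {V : Type*} (t : LTree (TermSym V)) (a : List ℕ) : Prop :=
  ∃ x, t (collapse a) = some (.lam x)

open Classical in
/-- The full position associated with `a`: it is `a · 0ⁿ` if the subterm at `a` is
`λ x₁ … xₙ. u` with `n ≥ 1` and `u` not an abstraction; if the subterm at `a` is not an
abstraction, it is the smallest `a'` such that `a = a' · 1ⁿ` for some `n`. -/
noncomputable def fullPos {V : Type*} (t : LTree (TermSym V)) (a : List ℕ) : List ℕ :=
  if IsAbsPos t a then
    a ++ List.replicate (sInf {n | ¬ IsAbsPos t (a ++ List.replicate n 0)}) 0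
  else a.rdropWhile (fun k => decide (k = 1))

/-- The set of full positions of `A`. -/
def fullPositions {V : Type*} (t : LTree (TermSym V)) (A : Set (List ℕ)) : Set (List ℕ) :=
  {a | a ∈ A ∧ fullPos t a = a}

/-- The relative degree `| |a| - |å| |`. -/
noncomputable def relDeg {V : Type*} (t : LTree (TermSym V)) (a : List ℕ) : ℕ :=
  ((a.length : ℤ) - (fullPos t a).length).natAbs

/-! ## The trivial construction

Templates are trees over the type variables `Sum.inl α` and the placeholders `Sum.inr a`, one
fresh placeholder for each position `a`. -/

/-- The placeholder of `a`, as a template. -/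
def placeholder {X : Type*} (a : List ℕ) : LTree (TySym (X ⊕ List ℕ)) := leaf (.var (.inr a))

/-- A type seen as a template without placeholders. -/
def embed {X : Type*} (T : LTree (TySym X)) : LTree (TySym (X ⊕ List ℕ)) :=
  fun c => (T c).map (TySym.map Sum.inl)

open Classical in
/-- The family `(tr a' · X_{a'})_{a' ∈ I}`, for `tr` injective on `I`. -/
noncomputable def family {X : Type*} (tr : List ℕ → ℕ) (I : Set (List ℕ)) : Seq (X ⊕ List ℕ) :=
  fun k => if h : ∃ a' ∈ I, tr a' = k then some (placeholder h.choose) else none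

/-- The template `E(a)(x)`: on track `tr a'` it holds the placeholder of `a'`, for every axiom
position `a'` of `x` above `a`. -/
noncomputable def ctxTemplate {V : Type*} (X : Type*) (t : LTree (TermSym V)) (A : Set (List ℕ))
    (tr : List ℕ → ℕ) (a : List ℕ) (x : V) : Seq (X ⊕ List ℕ) :=
  family tr (axPos t A a x)

/-- The sequence `E(a · 0)(x)` if the subterm at `a` is an abstraction over `x`. -/
noncomputable def binderTemplate {V : Type*} (X : Type*) (t : LTree (TermSym V))
    (A : Set (List ℕ)) (tr : List ℕ → ℕ) (a : List ℕ) : Seq (X ⊕ List ℕ) :=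
  match t (collapse a) with
  | some (.lam x) => ctxTemplate X t A tr (a ++ [0]) x
  | _ => Seq.empty

open Classical in
/-- The sequence of the placeholders of the positions `b · ℓ ∈ A`, `ℓ ≥ 2`, each on its own
track `ℓ`. -/
noncomputable def argTemplate (X : Type*) (A : Set (List ℕ)) (b : List ℕ) : Seq (X ⊕ List ℕ) :=
  fun l => if 2 ≤ l ∧ b ++ [l] ∈ A then some (placeholder (b ++ [l])) else none

open Classical in
/-- The template `S(a)`. With `n` the relative degree of `a` and `å` its full position, it is
`E(a · 0)(x₁) → ⋯ → E(a · 0ⁿ)(xₙ) → T(å)` if `a` is an abstraction position, and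
`F₁(a) → ⋯ → Fₙ(a) → T(å)` otherwise, where `F_k(a)` lists the arguments at `å · 1ⁿ⁻ᵏ`. If `a` is
full, then `n = 0` and this is `T(a)`. -/
noncomputable def template {V X : Type*} (t : LTree (TermSym V)) (A : Set (List ℕ))
    (tr : List ℕ → ℕ) (T : List ℕ → LTree (TySym X)) (a : List ℕ) :
    LTree (TySym (X ⊕ List ℕ)) :=
  arrows
    (if IsAbsPos t a then
      (List.range (relDeg t a)).map (fun i => binderTemplate X t A tr (a ++ List.replicate i 0))
    else
      (List.range (relDeg t a)).map (fun i =>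
        argTemplate X A (fullPos t a ++ List.replicate (relDeg t a - (i + 1)) 1)))
    (embed (T (fullPos t a)))

/-- If the root of a template is the placeholder of `a`, replace it by `S a`. -/
def resolve {X : Type*} (S : List ℕ → LTree (TySym (X ⊕ List ℕ)))
    (U : LTree (TySym (X ⊕ List ℕ))) : LTree (TySym (X ⊕ List ℕ)) :=
  match U [] with
  | some (.var (.inr a)) => S a
  | _ => U

/-- The symbol of a type at a position where there is no placeholder. -/
def readSym {X : Type*} : Option (TySym (X ⊕ List ℕ)) → Option (TySym X)
  | some (.var (.inl α)) => some (.var α)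
  | some .arrow => some .arrow
  | _ => none

/-- The tree obtained from the template `U` by replacing coinductively every placeholder of `a` by
`S a`; the placeholders are met from the root on. -/
def expand {X : Type*} (S : List ℕ → LTree (TySym (X ⊕ List ℕ))) :
    LTree (TySym (X ⊕ List ℕ)) → LTree (TySym X)
  | U, [] => readSym (resolve S U [])
  | U, k :: c => expand S (fun d => resolve S U (k :: d)) c

/-- The substitution `U[σ(a)/X_a]`. -/
def substitute {X : Type*} (σ : List ℕ → LTree (TySym X)) :
    LTree (TySym (X ⊕ List ℕ)) → LTree (TySym X)
  | U, [] =>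
    match U [] with
    | some (.var (.inr a)) => σ a []
    | s => readSym s
  | U, k :: c =>
    match U [] with
    | some (.var (.inr a)) => σ a (k :: c)
    | _ => substitute σ (fun d => U (k :: d)) c

/-- The types `T(a)` of the trivial construction. -/
noncomputable def builtType {V X : Type*} (t : LTree (TermSym V)) (A : Set (List ℕ))
    (tr : List ℕ → ℕ) (T : List ℕ → LTree (TySym X)) (a : List ℕ) : LTree (TySym X) :=
  expand (template t A tr T) (template t A tr T a)

/-- The contexts `C(a)(x) = E(a)(x)[T(a')/X_{a'}]` of the trivial construction. -/
noncomputable def builtCtx {V X : Type*} (t : LTree (TermSym V)) (A : Set (List ℕ))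
    (tr : List ℕ → ℕ) (T : List ℕ → LTree (TySym X)) (a : List ℕ) : Ctx V X :=
  fun x k => (ctxTemplate X t A tr a x k).map (substitute (builtType t A tr T))

open Classical in
/-- The trivial construction from the d-support `A` of `t`, the types `T a` given at the full
positions `a` of `A` and the axiom tracks `tr a` given at the axiom positions `a` of `A`. -/
noncomputable def trivialConstruction {V X : Type*} (t : LTree (TermSym V)) (A : Set (List ℕ))
    (tr : List ℕ → ℕ) (T : List ℕ → LTree (TySym X)) : LTree (Judgment V X) :=
  fun a => if a ∈ A then
    some ⟨builtCtx t A tr T a, subtree t (collapse a), builtType t A tr T a⟩ else none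

/-- The axiom tracks are at least `2` and cause no track conflict in the contexts. -/
def AdmissibleTracks {V : Type*} (t : LTree (TermSym V)) (A : Set (List ℕ))
    (tr : List ℕ → ℕ) : Prop :=
  ∀ a ∈ A, ∀ x, Set.InjOn tr (axPos t A a x) ∧ ∀ a' ∈ axPos t A a x, 2 ≤ tr a'

/-! The types of the construction solve the system `T(a) = S(a)[T(a')/X_{a'}]`. -/

theorem expand_eq_substitute {X : Type*} (S : List ℕ → LTree (TySym (X ⊕ List ℕ)))
    (hS : ∀ a a', S a [] ≠ some (.var (.inr a'))) (U : LTree (TySym (X ⊕ List ℕ))) :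
    expand S U = substitute (fun a => expand S (S a)) U := by
  have hres : ∀ a, resolve S (S a) = S a := by
    intro a
    unfold resolve
    split
    · rename_i a' h
      exact absurd h (hS a a')
    · rfl
  funext c
  induction c generalizing U with
  | nil =>
    rcases h : U [] with _ | (α | a) | _ <;> simp [expand, substitute, resolve, h]
    have := hres a
    unfold resolve at this
    rw [this]
  | cons k c ih =>
    rcases h : U [] with _ | (α | a) | _
    · simp only [expand, substitute, h, resolve]; exact ih _
    · simp only [expand, substitute, h, resolve]; exact ih _
    · simp only [expand, substitute, h, hres]
      simp only [resolve, h]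
    · simp only [expand, substitute, h, resolve]; exact ih _

theorem template_guarded {V X : Type*} (t : LTree (TermSym V)) (A : Set (List ℕ))
    (tr : List ℕ → ℕ) (T : List ℕ → LTree (TySym X)) (a a' : List ℕ) :
    template t A tr T a [] ≠ some (.var (.inr a')) := by
  have key : ∀ (L : List (Seq (X ⊕ List ℕ))) (U : LTree (TySym X)),
      arrows L (embed U) [] ≠ some (.var (.inr a')) := by
    intro L U
    cases L with
    | nil =>
      rcases h : U [] with _ | _ | _ <;> simp [arrows, embed, TySym.map, h]
    | cons F L => simp [arrows, arrow]
  exact key _ _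

theorem builtType_eq {V X : Type*} (t : LTree (TermSym V)) (A : Set (List ℕ))
    (tr : List ℕ → ℕ) (T : List ℕ → LTree (TySym X)) (a : List ℕ) :
    builtType t A tr T a = substitute (builtType t A tr T) (template t A tr T a) :=
  expand_eq_substitute _ (template_guarded t A tr T) _

end Rigid

open Rigid

namespace Rigid

/-! ## Positions -/

/-! In a normal form, the types at the full positions force all the others. The 001 condition
forbids an infinite run of abstractions, so track 0 leads from an abstraction to its full position
in finitely many steps. Normality forbids an abstraction to the left of an application, so the
position to the left of an application at `b` has the same full position as `b`. Along these steps
the typing rules become equations: `T(a) = C(a·0)(x) → T(a·0)` at an abstraction over `x`, and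
`T(b·1) = F → T(b)` at an application, with `F` the sequence of argument types at `b`.
Quantitativity expresses the contexts through the types at axiom positions, so the system is closed.
Every right-hand side is either a given type or an arrow; hence the system is guarded and has only
one solution.

The templates satisfy the same equations (`builtType_of_lam`, `builtType_concat_one`). Uniqueness of
the solution is then an induction on the position inside a type (`IsDerivationOf.builtType_eq_ty`).
Admissibility of the axiom tracks comes from the disjointness of contexts in the application rule
(`IsDerivationOf.admissibleTracks`).

Conversely, the same equations, with the recursion satisfied by the sets of axiom positions
(`mem_axPos_iff`), are the typing rules for the construction. The only condition on types that is
not local, the absence of branches ending in `1 1 1 …`, holds because track 1 of a type moves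
towards a full position, reached in finitely many steps (`isType_of_family`,
`IsDSupport.full_induction`).

Finally, axiom tracks are only names. Changing them acts on types by a recursion that follows the
same equations (`relabel`), and exchanging the two track functions gives the inverse. -/

theorem collapse_append (a b : List ℕ) : collapse (a ++ b) = collapse a ++ collapse b :=
  List.map_append

theorem collapse_concat (a : List ℕ) (k : ℕ) : collapse (a ++ [k]) = collapse a ++ [min k 2] := by
  simp [collapse]

theorem prefix_iff_eq_or_concat (a a' : List ℕ) :
    a <+: a' ↔ a' = a ∨ ∃ i, a ++ [i] <+: a' := by
  constructor
  · rintro ⟨c, rfl⟩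
    rcases c with _ | ⟨i, c⟩
    · simp
    · exact Or.inr ⟨i, c, by simp⟩
  · rintro (rfl | ⟨i, h⟩)
    · exact List.prefix_refl _
    · exact (List.prefix_append _ _).trans h

theorem concat_prefix_of_prefix {a b a' : List ℕ} {i : ℕ} (hab : a <+: b) (hba : b <+: a')
    (hi : a ++ [i] <+: a') (hne : b ≠ a) : a ++ [i] <+: b := by
  refine List.prefix_of_prefix_length_le hi hba ?_
  obtain ⟨c, rfl⟩ := hab
  rcases c with _ | ⟨j, c⟩
  · simp at hne
  · simp

/-! ## Terms -/

section Terms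

variable {V : Type*} {t : LTree (TermSym V)}

theorem IsTerm.ne_none_of_append (ht : IsTerm t) {b : List ℕ} (c : List ℕ)
    (h : t (b ++ c) ≠ none) : t b ≠ none := by
  induction c using List.reverseRecOn with
  | nil => simpa using h
  | append_singleton c k ih =>
    refine ih fun h' => h ?_
    rw [← List.append_assoc]
    exact ht.outside _ _ h'

theorem IsTerm.of_child (ht : IsTerm t) {b : List ℕ} {k : ℕ} (h : t (b ++ [k]) ≠ none) :
    (∃ x, t b = some (.lam x) ∧ k = 0) ∨ (t b = some .app ∧ (k = 1 ∨ k = 2)) := by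
  rcases hb : t b with _ | (x | x | _)
  · exact absurd (ht.outside _ _ hb) h
  · exact absurd (ht.var _ _ _ hb) h
  · exact Or.inl ⟨x, rfl, (ht.lam _ _ _ hb).1 h⟩
  · exact Or.inr ⟨rfl, (ht.app _ _ hb).1 h⟩

theorem IsTerm.of_collapse_child (ht : IsTerm t) {a : List ℕ} {k : ℕ}
    (h : t (collapse (a ++ [k])) ≠ none) :
    (∃ x, t (collapse a) = some (.lam x) ∧ k = 0) ∨ (t (collapse a) = some .app ∧ 1 ≤ k) := by
  rw [collapse_concat] at h
  rcases ht.of_child h with ⟨x, hx, hk⟩ | ⟨hx, hk⟩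
  · exact Or.inl ⟨x, hx, by omega⟩
  · exact Or.inr ⟨hx, by omega⟩

theorem IsTerm.lam_child (ht : IsTerm t) {a : List ℕ} {x : V}
    (h : t (collapse a) = some (.lam x)) (k : ℕ) : t (collapse (a ++ [k])) ≠ none ↔ k = 0 := by
  rw [collapse_concat, ht.lam _ _ _ h]
  omega

theorem IsTerm.app_child (ht : IsTerm t) {a : List ℕ}
    (h : t (collapse a) = some .app) (k : ℕ) : t (collapse (a ++ [k])) ≠ none ↔ 1 ≤ k := by
  rw [collapse_concat, ht.app _ _ h]
  omega

theorem IsTerm.app_of_one (ht : IsTerm t) {b : List ℕ} (h : t (collapse (b ++ [1])) ≠ none) :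
    t (collapse b) = some .app := by
  rcases ht.of_collapse_child h with ⟨x, _, hk⟩ | ⟨hx, _⟩
  · omega
  · exact hx

theorem not_isAbsPos_of_app {a : List ℕ} (h : t (collapse a) = some .app) : ¬ IsAbsPos t a := by
  rintro ⟨x, hx⟩
  simp [h] at hx

theorem IsNormalForm.not_isAbsPos_one (hnf : IsNormalForm t) {a : List ℕ}
    (h : t (collapse a) = some .app) : ¬ IsAbsPos t (a ++ [1]) := by
  rintro ⟨x, hx⟩
  rw [collapse_concat] at hx
  exact hnf _ x h hx

theorem subtree_subtree {σ : Type*} (T : LTree σ) (b c : List ℕ) :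
    subtree (subtree T b) c = subtree T (b ++ c) := by
  funext d
  simp [subtree]

theorem IsTerm.subtree (ht : IsTerm t) {b : List ℕ} (hb : t b ≠ none) :
    IsTerm (subtree t b) where
  root := by simpa [Rigid.subtree] using hb
  outside c k h := by
    simp only [Rigid.subtree, ← List.append_assoc] at *
    exact ht.outside _ _ h
  var c x k h := by
    simp only [Rigid.subtree, ← List.append_assoc] at *
    exact ht.var _ _ _ h
  lam c x k h := by
    simp only [Rigid.subtree, ← List.append_assoc] at *
    exact ht.lam _ _ _ h
  app c k h := by
    simp only [Rigid.subtree, ← List.append_assoc] at *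
    exact ht.app _ _ h

theorem Is001Term.subtree (ht : Is001Term t) {b : List ℕ} (hb : t b ≠ none) :
    Is001Term (subtree t b) where
  toIsTerm := ht.toIsTerm.subtree hb
  branch f hf := by
    -- `g` is the branch of `t` that runs through `b` and then follows `f`. Only finitely many of
    -- its argument tracks lie in `b`, so infinitely many come from `f`.
    let g : ℕ → ℕ := fun i => if h : i < b.length then b[i] else f (i - b.length)
    have hg : ∀ n, (List.range (b.length + n)).map g = b ++ (List.range n).map f := by
      intro n
      refine List.ext_getElem (by simp) fun i h₁ h₂ => ?_
      by_cases hi : i < b.length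
      · simp [g, hi]
      · simp [g, hi, List.getElem_append]
    have hinf := ht.branch g fun n => by
      have h := hf n
      have h' : t ((List.range (b.length + n)).map g) ≠ none := by
        rw [hg]; exact h
      rw [Nat.add_comm, List.range_add, List.map_append] at h'
      exact ht.ne_none_of_append _ h'
    intro hfin
    refine hinf (((Set.finite_Iio b.length).union (hfin.image (· + b.length))).subset ?_)
    intro i hi
    by_cases h : i < b.length
    · exact Or.inl h
    · refine Or.inr ⟨i - b.length, ?_, by simp; omega⟩
      simpa [g, h] using hi

/-- Otherwise the subterm at `a` would have the branch `0 0 0 …`, which visits no argument. -/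
theorem Is001Term.exists_not_isAbsPos (ht : Is001Term t) (a : List ℕ) :
    ∃ n, ¬ IsAbsPos t (a ++ List.replicate n 0) := by
  by_contra! h
  have h0 : t (collapse a) ≠ none := by
    obtain ⟨x, hx⟩ := h 0
    simp at hx
    simp [hx]
  have := (ht.subtree h0).branch (fun _ => 0) fun n => by
    obtain ⟨x, hx⟩ := h n
    rw [collapse_append] at hx
    have e : (List.range n).map (fun _ => 0) = collapse (List.replicate n 0) := by
      simp [collapse]
    rw [e]
    change t _ ≠ none
    simp [hx]
  simp at this

/-! ## Full positions -/

theorem sInf_not_isAbsPos_of_isAbsPos (ht : Is001Term t) {a : List ℕ} (h : IsAbsPos t a) :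
    sInf {n | ¬ IsAbsPos t (a ++ List.replicate n 0)} =
      sInf {n | ¬ IsAbsPos t (a ++ [0] ++ List.replicate n 0)} + 1 := by
  have h1 : 1 ≤ sInf {n | ¬ IsAbsPos t (a ++ List.replicate n 0)} := by
    -- The infimum of the empty set is also 0; that case is excluded by the 001 condition.
    rw [Nat.one_le_iff_ne_zero, Ne, Nat.sInf_eq_zero]
    rintro (h0 | h0)
    · exact h0 (by simpa using h)
    · obtain ⟨n, hn⟩ := ht.exists_not_isAbsPos a
      have : n ∈ (∅ : Set ℕ) := h0 ▸ hn
      exact this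
  rw [← Nat.sInf_add h1]
  simp [List.replicate_succ]

theorem sInf_not_isAbsPos_of_not {a : List ℕ} (h : ¬ IsAbsPos t a) :
    sInf {n | ¬ IsAbsPos t (a ++ List.replicate n 0)} = 0 :=
  Nat.sInf_eq_zero.2 (Or.inl (by simpa using h))

theorem fullPos_of_not {a : List ℕ} (h : ¬ IsAbsPos t a) :
    fullPos t a = a.rdropWhile (fun k => decide (k = 1)) := by
  simp [fullPos, h]

theorem fullPos_of_isAbsPos (ht : Is001Term t) {a : List ℕ} (h : IsAbsPos t a) :
    fullPos t a = fullPos t (a ++ [0]) := by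
  rw [fullPos, if_pos h, sInf_not_isAbsPos_of_isAbsPos ht h]
  by_cases h' : IsAbsPos t (a ++ [0])
  · rw [fullPos, if_pos h']
    simp [List.replicate_succ]
  -- Below the last binder the other clause of `fullPos` applies, but a position ending with 0 has
  -- no final 1 to strip.
  · rw [fullPos_of_not h', sInf_not_isAbsPos_of_not h', List.rdropWhile_concat_neg _ _ _ (by simp)]
    simp

theorem relDeg_of_isAbsPos {a : List ℕ} (h : IsAbsPos t a) :
    relDeg t a = sInf {n | ¬ IsAbsPos t (a ++ List.replicate n 0)} := by
  simp [relDeg, fullPos, h]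

theorem relDeg_of_full {a : List ℕ} (h : fullPos t a = a) : relDeg t a = 0 := by
  simp [relDeg, h]

theorem not_isAbsPos_of_full (ht : Is001Term t) {a : List ℕ} (h : fullPos t a = a) :
    ¬ IsAbsPos t a := by
  intro ha
  have := relDeg_of_full h
  rw [relDeg_of_isAbsPos ha, sInf_not_isAbsPos_of_isAbsPos ht ha] at this
  omega

theorem fullPos_concat_zero {a : List ℕ} (h : ¬ IsAbsPos t (a ++ [0])) :
    fullPos t (a ++ [0]) = a ++ [0] := by
  rw [fullPos_of_not h, List.rdropWhile_concat_neg _ _ _ (by simp)]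

/-- The second hypothesis is what normality provides. If `a · 1` were an abstraction, its full
position would lie above it instead of on the spine of `a`. -/
theorem fullPos_concat_one {a : List ℕ} (h : ¬ IsAbsPos t a) (h' : ¬ IsAbsPos t (a ++ [1])) :
    fullPos t (a ++ [1]) = fullPos t a := by
  rw [fullPos_of_not h', fullPos_of_not h, List.rdropWhile_concat_pos _ _ _ (by simp)]

theorem length_fullPos_le {a : List ℕ} (h : ¬ IsAbsPos t a) : (fullPos t a).length ≤ a.length := by
  rw [fullPos_of_not h]
  exact (List.rdropWhile_prefix _ _).length_le

theorem relDeg_of_not {a : List ℕ} (h : ¬ IsAbsPos t a) :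
    relDeg t a = a.length - (fullPos t a).length := by
  have := length_fullPos_le h
  unfold relDeg
  omega

theorem relDeg_concat_one {a : List ℕ} (h : ¬ IsAbsPos t a) (h' : ¬ IsAbsPos t (a ++ [1])) :
    relDeg t (a ++ [1]) = relDeg t a + 1 := by
  have := length_fullPos_le h
  rw [relDeg_of_not h, relDeg_of_not h', fullPos_concat_one h h']
  simp
  omega

theorem fullPos_append_replicate {a : List ℕ} (h : ¬ IsAbsPos t a) :
    fullPos t a ++ List.replicate (relDeg t a) 1 = a := by
  rw [relDeg_of_not h, fullPos_of_not h]
  clear h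
  induction a using List.reverseRecOn with
  | nil => simp
  | append_singleton a k ih =>
    by_cases hk : k = 1
    · subst hk
      have := (List.rdropWhile_prefix (fun k => decide (k = 1)) a).length_le
      rw [List.rdropWhile_concat_pos _ _ _ (by simp), List.length_append, List.length_singleton,
        Nat.sub_add_comm this, List.replicate_succ', ← List.append_assoc, ih]
    · rw [List.rdropWhile_concat_neg _ _ _ (by simp [hk])]
      simp

theorem fullPos_concat_one_ne {b : List ℕ} (h : ¬ IsAbsPos t (b ++ [1])) :
    fullPos t (b ++ [1]) ≠ b ++ [1] := by
  rw [fullPos_of_not h, List.rdropWhile_concat_pos _ _ _ (by simp)]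
  intro e
  have := (List.rdropWhile_prefix (fun k => decide (k = 1)) b).length_le
  rw [e] at this
  simp at this

/-- A position is full, or an abstraction position, or the left child of some position. -/
theorem full_or_isAbsPos_or_concat_one (t : LTree (TermSym V)) (a : List ℕ) :
    fullPos t a = a ∨ IsAbsPos t a ∨ ∃ b, a = b ++ [1] ∧ ¬ IsAbsPos t a := by
  by_cases h : IsAbsPos t a
  · exact Or.inr (Or.inl h)
  · induction a using List.reverseRecOn with
    | nil => left; simp [fullPos_of_not h]
    | append_singleton a k ih =>
      by_cases hk : k = 1
      · exact Or.inr (Or.inr ⟨a, by rw [hk], h⟩)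
      · left
        rw [fullPos_of_not h, List.rdropWhile_concat_neg _ _ _ (by simp [hk])]

/-! ## Axiom positions -/

/-- Freeness is unfolded one node at a time. The sets of axiom positions thus obey the same
recursion as the contexts in the three rules, as the cases `mem_axPos_of_var`, `mem_axPos_of_lam`
and `mem_axPos_of_app` show. -/
theorem mem_axPos_iff {A : Set (List ℕ)} {a a' : List ℕ} {x : V} :
    a' ∈ axPos t A a x ↔ (a' = a ∧ a ∈ A ∧ t (collapse a) = some (.var x)) ∨
      (t (collapse a) ≠ some (.lam x) ∧ ∃ i, a' ∈ axPos t A (a ++ [i]) x) := by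
  constructor
  · rintro ⟨hA, hp, hv, hl⟩
    rcases (prefix_iff_eq_or_concat _ _).1 hp with rfl | ⟨i, hi⟩
    · exact Or.inl ⟨rfl, hA, hv⟩
    · exact Or.inr ⟨hl _ (List.prefix_refl _) hp, i, hA, hi, hv,
        fun b hb => hl b ((List.prefix_append _ _).trans hb)⟩
  · rintro (⟨rfl, hA, hv⟩ | ⟨hl, i, hA, hi, hv, hl'⟩)
    · refine ⟨hA, List.prefix_refl _, hv, fun b hb hb' => ?_⟩
      rw [hb.eq_of_length_le hb'.length_le] at hv
      simp [hv]
    · refine ⟨hA, (List.prefix_append _ _).trans hi, hv, fun b hb hb' => ?_⟩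
      by_cases e : b = a
      · rwa [e]
      · exact hl' b (concat_prefix_of_prefix hb hb' hi e) hb'

theorem collapse_ne_none_of_mem_axPos (ht : IsTerm t) {A : Set (List ℕ)} {a a' : List ℕ} {x : V}
    (h : a' ∈ axPos t A a x) : t (collapse a) ≠ none := by
  obtain ⟨-, ⟨c, rfl⟩, hv, -⟩ := h
  rw [collapse_append] at hv
  exact ht.ne_none_of_append (collapse c) (by simp [hv])

theorem mem_axPos_of_var (ht : IsTerm t) {A : Set (List ℕ)} {a a' : List ℕ} {x y : V}
    (ha : a ∈ A) (h : t (collapse a) = some (.var x)) : a' ∈ axPos t A a y ↔ a' = a ∧ y = x := by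
  rw [mem_axPos_iff, h]
  constructor
  · rintro (⟨rfl, -, e⟩ | ⟨-, i, hi⟩)
    · simp_all
    · rcases ht.of_collapse_child (collapse_ne_none_of_mem_axPos ht hi) with ⟨_, e, _⟩ | ⟨e, _⟩ <;>
      simp [h] at e
  · rintro ⟨rfl, rfl⟩
    exact Or.inl ⟨rfl, ha, rfl⟩

theorem mem_axPos_of_lam (ht : IsTerm t) {A : Set (List ℕ)} {a a' : List ℕ} {x y : V}
    (h : t (collapse a) = some (.lam x)) :
    a' ∈ axPos t A a y ↔ y ≠ x ∧ a' ∈ axPos t A (a ++ [0]) y := by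
  rw [mem_axPos_iff, h]
  constructor
  · rintro (⟨rfl, -, e⟩ | ⟨e, i, hi⟩)
    · simp at e
    · obtain rfl := (ht.lam_child h i).1 (collapse_ne_none_of_mem_axPos ht hi)
      exact ⟨fun e' => e (by rw [e']), hi⟩
  · rintro ⟨e, h'⟩
    exact Or.inr ⟨by simpa using fun e' => e e'.symm, 0, h'⟩

theorem mem_axPos_of_app {A : Set (List ℕ)} {a a' : List ℕ} {y : V}
    (h : t (collapse a) = some .app) :
    a' ∈ axPos t A a y ↔ ∃ i, a' ∈ axPos t A (a ++ [i]) y := by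
  rw [mem_axPos_iff, h]
  simp

theorem eq_of_mem_axPos_concat {A : Set (List ℕ)} {a a' : List ℕ} {x y : V} {i j : ℕ}
    (hi : a' ∈ axPos t A (a ++ [i]) x) (hj : a' ∈ axPos t A (a ++ [j]) y) : i = j := by
  have := List.prefix_of_prefix_length_le hi.2.1 hj.2.1 (by simp)
  simpa using this.eq_of_length (by simp)

end Terms

/-! ## Derivation supports -/

section DSupport

variable {V : Type*} {t : LTree (TermSym V)} {A : Set (List ℕ)}

/-- The priority order is used through two closure properties: under prefixes, from here, and under
children on tracks 0 and 1 that stay in the term, from `IsDSupport.concat_mem`. -/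
theorem IsDSupport.of_concat (hA : IsDSupport t A) (ht : IsTerm t) {a : List ℕ} {k : ℕ}
    (h : a ++ [k] ∈ A) : a ∈ A := by
  refine hA.down _ _ h ?_ ⟨a, List.prefix_refl _, List.prefix_append _ _, rfl, ?_⟩
  · have := hA.sub _ h
    rw [collapse_append] at this
    exact ht.ne_none_of_append _ this
  · simp [appDepth]

theorem IsDSupport.of_prefix (hA : IsDSupport t A) (ht : IsTerm t) {a b : List ℕ} (h : a <+: b)
    (hb : b ∈ A) : a ∈ A := by
  obtain ⟨c, rfl⟩ := h
  induction c using List.reverseRecOn with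
  | nil => simpa using hb
  | append_singleton c k ih =>
    rw [← List.append_assoc] at hb
    exact ih (hA.of_concat ht hb)

theorem IsDSupport.nil_mem (hA : IsDSupport t A) (ht : IsTerm t) : [] ∈ A := by
  obtain ⟨a, ha⟩ := hA.nonempty
  exact hA.down _ _ ha ht.root ⟨[], List.prefix_refl _, List.nil_prefix, rfl, by simp [appDepth]⟩

theorem IsDSupport.concat_mem (hA : IsDSupport t A) {a : List ℕ} {k : ℕ} (ha : a ∈ A) (hk : k < 2)
    (h : t (collapse (a ++ [k])) ≠ none) : a ++ [k] ∈ A :=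
  hA.down _ _ ha h ⟨a, List.prefix_append _ _, List.prefix_refl _, by simp [appDepth, hk], le_rfl⟩

theorem IsDSupport.app_of_one_mem (hA : IsDSupport t A) (ht : IsTerm t) {b : List ℕ}
    (h : b ++ [1] ∈ A) : t (collapse b) = some .app :=
  ht.app_of_one (hA.sub _ h)

theorem IsDSupport.zero_mem (hA : IsDSupport t A) (ht : IsTerm t) {a : List ℕ} {x : V}
    (ha : a ∈ A) (h : t (collapse a) = some (.lam x)) : a ++ [0] ∈ A :=
  hA.concat_mem ha (by norm_num) ((ht.lam_child h 0).2 rfl)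

/-- Induction towards the full position. -/
theorem IsDSupport.full_induction (hA : IsDSupport t A) (ht : Is001Term t) {p : List ℕ → Prop}
    (full : ∀ a ∈ A, fullPos t a = a → p a)
    (lam : ∀ a ∈ A, ∀ x, t (collapse a) = some (.lam x) → p (a ++ [0]) → p a)
    (one : ∀ b, b ++ [1] ∈ A → b ∈ A → t (collapse b) = some .app → ¬ IsAbsPos t (b ++ [1]) →
      p b → p (b ++ [1])) :
    ∀ a ∈ A, p a := by
  -- Off abstractions, final tracks 1 are removed one by one; the remaining position is full.
  have key : ∀ a ∈ A, ¬ IsAbsPos t a → p a := by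
    intro a
    induction a using List.reverseRecOn with
    | nil => exact fun ha h => full _ ha (by simp [fullPos_of_not h])
    | append_singleton b k ih =>
      intro ha h
      by_cases hk : k = 1
      · subst hk
        have hb := hA.of_concat ht.toIsTerm ha
        have happ := hA.app_of_one_mem ht.toIsTerm ha
        exact one b ha hb happ h (ih hb (not_isAbsPos_of_app happ))
      · refine full _ ha ?_
        rw [fullPos_of_not h, List.rdropWhile_concat_neg _ _ _ (by simp [hk])]
  -- Abstractions reduce to the previous case by induction on the number of tracks 0 to add.
  have key' : ∀ n, ∀ a ∈ A, ¬ IsAbsPos t (a ++ List.replicate n 0) → p a := by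
    intro n
    induction n with
    | zero => exact fun a ha h => key a ha (by simpa using h)
    | succ n ih =>
      intro a ha h
      by_cases h' : IsAbsPos t a
      · obtain ⟨x, hx⟩ := h'
        exact lam a ha x hx (ih _ (hA.zero_mem ht.toIsTerm ha hx)
          (by simpa [List.replicate_succ] using h))
      · exact key a ha h'
  intro a ha
  obtain ⟨n, hn⟩ := ht.exists_not_isAbsPos a
  exact key' n a ha hn

end DSupport

/-! ## Arrows and substitution -/

section Arrow

variable {X : Type*}

@[simp] theorem arrow_nil (F : Seq X) (T : LTree (TySym X)) : arrow F T [] = some .arrow := rfl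

@[simp] theorem arrow_zero (F : Seq X) (T : LTree (TySym X)) (c : List ℕ) :
    arrow F T (0 :: c) = none := rfl

@[simp] theorem arrow_one (F : Seq X) (T : LTree (TySym X)) (c : List ℕ) :
    arrow F T (1 :: c) = T c := rfl

theorem arrow_of_two_le (F : Seq X) (T : LTree (TySym X)) {k : ℕ} (hk : 2 ≤ k) (c : List ℕ) :
    arrow F T (k :: c) = (F k).bind (fun U => U c) := by
  obtain ⟨k, rfl⟩ := Nat.exists_eq_add_of_le' hk
  rfl

theorem substitute_none (σ : List ℕ → LTree (TySym X)) (c : List ℕ) :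
    substitute σ (fun _ => none) c = none := by
  induction c with
  | nil => rfl
  | cons k c ih => exact ih

theorem substitute_arrow (σ : List ℕ → LTree (TySym X)) (F : Seq (X ⊕ List ℕ))
    (U : LTree (TySym (X ⊕ List ℕ))) :
    substitute σ (arrow F U) = arrow (fun k => (F k).map (substitute σ)) (substitute σ U) := by
  funext c
  match c with
  | [] => rfl
  | 0 :: c => exact substitute_none σ c
  | 1 :: c => rfl
  | (k + 2) :: c =>
    rw [arrow_of_two_le _ _ (by omega)]
    change substitute σ (fun d => (F (k + 2)).bind (fun U => U d)) c = _
    rcases F (k + 2) with _ | U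
    · exact substitute_none σ c
    · rfl

theorem substitute_embed (σ : List ℕ → LTree (TySym X)) (T : LTree (TySym X)) :
    substitute σ (embed T) = T := by
  funext c
  induction c generalizing T with
  | nil => rcases h : T [] with _ | _ | _ <;> simp [substitute, embed, h, TySym.map, readSym]
  | cons k c ih =>
    have := ih fun d => T (k :: d)
    rcases h : T [] with _ | _ | _ <;> simp [substitute, embed, h, TySym.map] <;> exact this

theorem substitute_placeholder (σ : List ℕ → LTree (TySym X)) (a : List ℕ) :
    substitute σ (placeholder a) = σ a := by
  funext c
  cases c <;> rfl

/-- A family of trees is made of types if each of them is a type or an arrow between members of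
the family, and none of them ends by `1 1 1 …` from the root. -/
theorem isType_of_family {ι : Type*} (B : ι → LTree (TySym X)) (s : Set ι)
    (step : ∀ i ∈ s, IsType (B i) ∨ ∃ F, ∃ j ∈ s, B i = arrow F (B j) ∧
      ∀ k U, 2 ≤ k → F k = some U → ∃ l ∈ s, U = B l)
    (spine : ∀ i ∈ s, ∃ n, B i (List.replicate n 1) = none) :
    ∀ i ∈ s, IsType (B i) := by
  have root : ∀ i ∈ s, B i [] ≠ none := by
    intro i hi
    rcases step i hi with h | ⟨F, j, hj, e, -⟩
    · exact h.root
    · simp [e]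
  -- Below a root, each child subtree is empty or again a member of the family. Every condition at a
  -- position is thereby moved to a shorter position, until it meets a type or a root.
  have child : ∀ i ∈ s, ¬ IsType (B i) → B i [] = some .arrow ∧ B i [0] = none ∧
      B i [1] ≠ none ∧ ∀ k, (∀ c, B i (k :: c) = none) ∨ ∃ l ∈ s, ∀ c, B i (k :: c) = B l c := by
    intro i hi h
    rcases step i hi with h' | ⟨F, j, hj, e, hF⟩
    · exact absurd h' h
    · refine ⟨by simp [e], by simp [e], by simpa [e] using root j hj, fun k => ?_⟩
      match k with
      | 0 => left; simp [e]
      | 1 => right; exact ⟨j, hj, by simp [e]⟩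
      | k + 2 =>
        rcases h : F (k + 2) with _ | U
        · left; simp [e, arrow, h]
        · obtain ⟨l, hl, rfl⟩ := hF _ _ (by omega) h
          right; exact ⟨l, hl, by simp [e, arrow, h]⟩
  intro i hi
  refine ⟨root i hi, ?_, ?_, ?_, ?_⟩
  · intro c k
    induction c generalizing i with
    | nil => exact fun h => absurd h (root i hi)
    | cons j c ih =>
      by_cases h : IsType (B i)
      · exact h.outside _ _
      · rcases (child i hi h).2.2.2 j with h | ⟨l, hl, h⟩
        · simp [h]
        · simpa [h] using ih l hl
  · intro c α k
    induction c generalizing i with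
    | nil =>
      by_cases h : IsType (B i)
      · exact h.var _ _ _
      · simp [(child i hi h).1]
    | cons j c ih =>
      by_cases h : IsType (B i)
      · exact h.var _ _ _
      · rcases (child i hi h).2.2.2 j with h | ⟨l, hl, h⟩
        · simp [h]
        · simpa [h] using ih l hl
  · intro c
    induction c generalizing i with
    | nil =>
      by_cases h : IsType (B i)
      · exact h.arrow _
      · exact fun _ => ⟨(child i hi h).2.1, (child i hi h).2.2.1⟩
    | cons j c ih =>
      by_cases h : IsType (B i)
      · exact h.arrow _
      · rcases (child i hi h).2.2.2 j with h | ⟨l, hl, h⟩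
        · simp [h]
        · simpa [h] using ih l hl
  · intro c
    induction c generalizing i with
    | nil => simpa using spine i hi
    | cons j c ih =>
      by_cases h : IsType (B i)
      · exact h.branch _
      · rcases (child i hi h).2.2.2 j with h | ⟨l, hl, h⟩
        · simp [h]
        · simpa [h] using ih l hl

end Arrow

/-! ## The equations of the trivial construction -/

section Built

variable {V X : Type*} {t : LTree (TermSym V)} {A : Set (List ℕ)} {tr : List ℕ → ℕ}
  {T : List ℕ → LTree (TySym X)}

theorem builtType_of_full {a : List ℕ} (h : fullPos t a = a) : builtType t A tr T a = T a := by
  rw [builtType_eq, template, relDeg_of_full h]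
  simp [arrows, substitute_embed, h]

theorem builtType_of_lam (ht : Is001Term t) {a : List ℕ} {x : V}
    (h : t (collapse a) = some (.lam x)) :
    builtType t A tr T a =
      arrow (builtCtx t A tr T (a ++ [0]) x) (builtType t A tr T (a ++ [0])) := by
  have ha : IsAbsPos t a := ⟨x, h⟩
  have hb : binderTemplate X t A tr a = ctxTemplate X t A tr (a ++ [0]) x := by
    simp [binderTemplate, h]
  have key : template t A tr T a =
      arrow (ctxTemplate X t A tr (a ++ [0]) x) (template t A tr T (a ++ [0])) := by
    rw [template, if_pos ha, relDeg_of_isAbsPos ha, sInf_not_isAbsPos_of_isAbsPos ht ha,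
      fullPos_of_isAbsPos ht ha, List.range_succ_eq_map]
    -- At the last binder the template of `a · 0` changes shape: `a · 0` is full and there is no
    -- arrow left.
    by_cases h' : IsAbsPos t (a ++ [0])
    · rw [template, if_pos h', relDeg_of_isAbsPos h']
      simp [arrows, hb, List.replicate_succ, Function.comp_def]
    · rw [template, if_neg h', sInf_not_isAbsPos_of_not h', relDeg_of_full (fullPos_concat_zero h')]
      simp [arrows, hb]
  rw [builtType_eq, key, substitute_arrow, ← builtType_eq]
  rfl

-- The template of `b · 1` is that of `b` with one more arrow in front. The new argument list, of
-- index 0, is taken at `å` followed by as many tracks 1 as the relative degree of `b`, which is `b`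
-- itself.
open Classical in
theorem builtType_concat_one {b : List ℕ} (h : ¬ IsAbsPos t b) (h' : ¬ IsAbsPos t (b ++ [1])) :
    builtType t A tr T (b ++ [1]) =
      arrow (fun l => if 2 ≤ l ∧ b ++ [l] ∈ A then some (builtType t A tr T (b ++ [l])) else none)
        (builtType t A tr T b) := by
  have key : template t A tr T (b ++ [1]) = arrow (argTemplate X A b) (template t A tr T b) := by
    rw [template, if_neg h', template, if_neg h, relDeg_concat_one h h', fullPos_concat_one h h',
      List.range_succ_eq_map]
    simp [arrows, Function.comp_def, fullPos_append_replicate h]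
  rw [builtType_eq, key, substitute_arrow, ← builtType_eq]
  congr 1
  funext l
  by_cases hl : 2 ≤ l ∧ b ++ [l] ∈ A <;> simp [argTemplate, hl, substitute_placeholder]

/-- By injectivity of the tracks, the position chosen in `family` is the only candidate, so the
choice disappears from all later arguments. -/
theorem builtCtx_eq_some {a : List ℕ} {x : V} (h : Set.InjOn tr (axPos t A a x)) {k : ℕ}
    {U : LTree (TySym X)} :
    builtCtx t A tr T a x k = some U ↔
      ∃ a' ∈ axPos t A a x, tr a' = k ∧ builtType t A tr T a' = U := by
  unfold builtCtx ctxTemplate family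
  by_cases hk : ∃ a' ∈ axPos t A a x, tr a' = k
  · obtain ⟨h1, h2⟩ := hk.choose_spec
    rw [dif_pos hk, Option.map_some, substitute_placeholder, Option.some_inj]
    constructor
    · exact fun e => ⟨_, h1, h2, e⟩
    · rintro ⟨a', h1', h2', e⟩
      rwa [h h1 h1' (h2.trans h2'.symm)]
  · rw [dif_neg hk]
    simp only [Option.map_none, reduceCtorEq, false_iff]
    rintro ⟨a', h1, h2, -⟩
    exact hk ⟨a', h1, h2⟩

theorem builtCtx_ext {a : List ℕ} {x : V} (h : Set.InjOn tr (axPos t A a x)) {F : Seq X}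
    (hF : ∀ k U, F k = some U ↔
      ∃ a' ∈ axPos t A a x, tr a' = k ∧ builtType t A tr T a' = U) :
    builtCtx t A tr T a x = F := by
  funext k
  ext U
  rw [hF, builtCtx_eq_some h]

theorem isType_builtType (ht : Is001Term t) (hA : IsDSupport t A) (htr : AdmissibleTracks t A tr)
    (hT : ∀ a ∈ fullPositions t A, IsType (T a)) : ∀ a ∈ A, IsType (builtType t A tr T a) := by
  classical
  refine isType_of_family _ _ (fun a ha => ?_) ?_
  · rcases full_or_isAbsPos_or_concat_one t a with h | ⟨x, h⟩ | ⟨b, rfl, h⟩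
    · rw [builtType_of_full h]
      exact Or.inl (hT a ⟨ha, h⟩)
    · have h0 := hA.zero_mem ht.toIsTerm ha h
      refine Or.inr ⟨_, _, h0, builtType_of_lam ht h, fun k U _ hU => ?_⟩
      obtain ⟨a', h1, -, e⟩ := (builtCtx_eq_some (htr _ h0 x).1).1 hU
      exact ⟨a', h1.1, e.symm⟩
    · refine Or.inr ⟨_, _, hA.of_concat ht.toIsTerm ha, builtType_concat_one
        (not_isAbsPos_of_app (hA.app_of_one_mem ht.toIsTerm ha)) h, fun k U _ hU => ?_⟩
      simp only [Option.ite_none_right_eq_some, Option.some_inj] at hU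
      exact ⟨_, hU.1.2, hU.2.symm⟩
  -- Each step towards the full position adds one track 1 at the front of the spine; at a full
  -- position the given type bounds the spine.
  · refine hA.full_induction ht ?_ ?_ ?_
    · intro a ha h
      rw [builtType_of_full h]
      simpa using (hT a ⟨ha, h⟩).branch []
    · rintro a ha x h ⟨n, hn⟩
      exact ⟨n + 1, by simpa [builtType_of_lam ht h, List.replicate_succ] using hn⟩
    · rintro b - - h h' ⟨n, hn⟩
      exact ⟨n + 1, by
        simpa [builtType_concat_one (not_isAbsPos_of_app h) h', List.replicate_succ] using hn⟩

/-! ### The typing rules in the trivial construction -/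

theorem trivialConstruction_eq_some {a : List ℕ} {J : Judgment V X} :
    trivialConstruction t A tr T a = some J ↔
      a ∈ A ∧ ⟨builtCtx t A tr T a, subtree t (collapse a), builtType t A tr T a⟩ = J := by
  unfold trivialConstruction
  split_ifs with h <;> simp [h]

theorem trivialConstruction_of_mem {a : List ℕ} (h : a ∈ A) :
    trivialConstruction t A tr T a =
      some ⟨builtCtx t A tr T a, subtree t (collapse a), builtType t A tr T a⟩ :=
  trivialConstruction_eq_some.2 ⟨h, rfl⟩

theorem trivialConstruction_eq_none {a : List ℕ} :
    trivialConstruction t A tr T a = none ↔ a ∉ A := by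
  unfold trivialConstruction
  split_ifs with h <;> simp [h]

theorem supp_trivialConstruction : supp (trivialConstruction t A tr T) = A := by
  ext a
  simp [supp, trivialConstruction_eq_none]

theorem Judgment.ax_ctx_eq_some {x y : V} {k l : ℕ} {U W : LTree (TySym X)} :
    (Judgment.ax x k U).ctx y l = some W ↔ y = x ∧ l = k ∧ U = W := by
  simp [Judgment.ax, Ctx.single, and_assoc]

theorem subtree_of_var (ht : IsTerm t) {b : List ℕ} {x : V} (h : t b = some (.var x)) :
    subtree t b = termVar x := by
  funext c
  rcases c with _ | ⟨k, c⟩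
  · simpa [subtree, termVar, leaf] using h
  · by_contra hne
    refine absurd (ht.var _ _ k h) (ht.ne_none_of_append c ?_)
    simpa [subtree, termVar, leaf] using hne

theorem subtree_of_lam (ht : IsTerm t) {b : List ℕ} {x : V} (h : t b = some (.lam x)) :
    subtree t b = termLam x (subtree t (b ++ [0])) := by
  funext c
  match c with
  | [] => simpa [subtree, termLam] using h
  | 0 :: c => simp [subtree, termLam]
  | (k + 1) :: c =>
    by_contra hne
    have := ht.ne_none_of_append (b := b ++ [k + 1]) c (by simpa [subtree, termLam] using hne)
    simpa using (ht.lam _ _ _ h).1 this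

theorem subtree_of_app (ht : IsTerm t) {b : List ℕ} (h : t b = some .app) :
    subtree t b = termApp (subtree t (b ++ [1])) (subtree t (b ++ [2])) := by
  funext c
  match c with
  | [] => simpa [subtree, termApp] using h
  | 1 :: c => simp [subtree, termApp]
  | 2 :: c => simp [subtree, termApp]
  | 0 :: c =>
    by_contra hne
    have := ht.ne_none_of_append (b := b ++ [0]) c (by simpa [subtree, termApp] using hne)
    simpa using (ht.app _ _ h).1 this
  | (k + 3) :: c =>
    by_contra hne
    have := ht.ne_none_of_append (b := b ++ [k + 3]) c (by simpa [subtree, termApp] using hne)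
    have := (ht.app _ _ h).1 this
    omega

theorem trivialConstruction_of_var (ht : IsTerm t) (htr : AdmissibleTracks t A tr) {a : List ℕ}
    (ha : a ∈ A) {x : V} (h : t (collapse a) = some (.var x)) :
    trivialConstruction t A tr T a = some (Judgment.ax x (tr a) (builtType t A tr T a)) := by
  rw [trivialConstruction_of_mem ha, Option.some_inj]
  refine Judgment.ext ?_ (subtree_of_var ht h) rfl
  funext y
  refine builtCtx_ext (htr a ha y).1 fun k U => ?_
  rw [Judgment.ax_ctx_eq_some]
  simp only [mem_axPos_of_var ht ha h]
  constructor
  · rintro ⟨rfl, rfl, rfl⟩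
    exact ⟨a, ⟨rfl, rfl⟩, rfl, rfl⟩
  · rintro ⟨_, ⟨rfl, rfl⟩, rfl, rfl⟩
    exact ⟨rfl, rfl, rfl⟩

theorem var_of_trivialConstruction_eq_ax (ht : IsTerm t) (htr : AdmissibleTracks t A tr)
    {a : List ℕ} {x : V} {k : ℕ} {U : LTree (TySym X)}
    (h : trivialConstruction t A tr T a = some (Judgment.ax x k U)) :
    a ∈ A ∧ t (collapse a) = some (.var x) ∧ tr a = k ∧ builtType t A tr T a = U := by
  obtain ⟨ha, e⟩ := trivialConstruction_eq_some.1 h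
  have hx : t (collapse a) = some (.var x) := by
    have := congrArg (fun J : Judgment V X => J.subj []) e
    simpa [subtree, Judgment.ax, termVar, leaf] using this
  rw [trivialConstruction_of_var ht htr ha hx, Option.some_inj] at h
  -- The context of an axiom has a single entry, from which its track and its type are read off.
  have := (Judgment.ax_ctx_eq_some (x := x) (k := k) (U := U)).2 ⟨rfl, rfl, rfl⟩
  rw [← h, Judgment.ax_ctx_eq_some] at this
  exact ⟨ha, hx, this.2.1.symm, this.2.2⟩

theorem isDerivation_trivialConstruction (ht : Is001Term t) (hnf : IsNormalForm t)
    (hA : IsDSupport t A) (htr : AdmissibleTracks t A tr)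
    (hT : ∀ a ∈ fullPositions t A, IsType (T a)) :
    IsDerivation (trivialConstruction t A tr T) where
  root := by
    rw [Ne, trivialConstruction_eq_none, not_not]
    exact hA.nil_mem ht.toIsTerm
  outside a k h := by
    rw [trivialConstruction_eq_none] at *
    exact fun h' => h (hA.of_concat ht.toIsTerm h')
  valid a J h := by
    obtain ⟨ha, rfl⟩ := trivialConstruction_eq_some.1 h
    refine ⟨fun x k U hU => ?_, ht.subtree (hA.sub a ha), isType_builtType ht hA htr hT a ha⟩
    obtain ⟨a', ha', rfl, rfl⟩ := (builtCtx_eq_some (htr a ha x).1).1 hU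
    exact ⟨(htr a ha x).2 a' ha', isType_builtType ht hA htr hT a' ha'.1⟩
  rule a J h := by
    obtain ⟨ha, hJ⟩ := trivialConstruction_eq_some.1 h
    rcases hx : t (collapse a) with _ | (x | x | _)
    · exact absurd hx (hA.sub a ha)
    · rw [trivialConstruction_of_var ht.toIsTerm htr ha hx, Option.some_inj] at h
      refine Or.inl ⟨x, tr a, _, (htr a ha x).2 a
        ((mem_axPos_of_var ht.toIsTerm ha hx).2 ⟨rfl, rfl⟩), h.symm, fun i => ?_⟩
      rw [trivialConstruction_eq_none]
      intro hi
      have := hA.sub _ hi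
      rw [collapse_concat] at this
      exact this (ht.var _ _ _ hx)
    · have h0 := hA.zero_mem ht.toIsTerm ha hx
      refine Or.inr (Or.inl ⟨x, _, trivialConstruction_of_mem h0, fun i hi => ?_, ?_⟩)
      · rw [trivialConstruction_eq_none]
        exact fun hi' => hi ((ht.lam_child hx i).1 (hA.sub _ hi'))
      · rw [← hJ]
        refine Judgment.ext ?_ ?_ (builtType_of_lam ht hx)
        · funext y
          refine builtCtx_ext (htr a ha y).1 fun k U => ?_
          simp only [mem_axPos_of_lam ht.toIsTerm hx, Ctx.erase]
          by_cases hy : y = x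
          · simp [hy, Seq.empty]
          · simp [hy, builtCtx_eq_some (htr _ h0 y).1]
        · change subtree t (collapse a) = _
          rw [subtree_of_lam ht.toIsTerm hx, collapse_concat]
          rfl
    · have h1 : a ++ [1] ∈ A := hA.concat_mem ha (by norm_num) ((ht.app_child hx 1).2 le_rfl)
      refine Or.inr (Or.inr ⟨subtree t (collapse a ++ [2]), _, ?_, trivialConstruction_of_mem h1,
        ?_, ?_, ?_, ?_, ?_⟩)
      · rw [trivialConstruction_eq_none]
        intro h0
        have := (ht.app_child hx 0).1 (hA.sub _ h0)
        omega
      · rw [← hJ]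
        change subtree t (collapse a) = _
        rw [subtree_of_app ht.toIsTerm hx, collapse_concat]
        rfl
      · intro k D hk hD
        obtain ⟨-, rfl⟩ := trivialConstruction_eq_some.1 hD
        simp [collapse_concat, hk]
      · change builtType t A tr T (a ++ [1]) = _
        -- Normality is needed here: the left premise is not an abstraction, so its type is an arrow
        -- from the argument types.
        rw [builtType_concat_one (not_isAbsPos_of_app hx) (hnf.not_isAbsPos_one hx), ← hJ]
        congr 1
        funext l
        by_cases hl : 2 ≤ l <;> by_cases hl' : a ++ [l] ∈ A <;>
        simp [argTypes, trivialConstruction, hl, hl']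
      · intro i j D D' x k hD hD' hk hk'
        obtain ⟨hi, rfl⟩ := trivialConstruction_eq_some.1 hD
        obtain ⟨hj, rfl⟩ := trivialConstruction_eq_some.1 hD'
        obtain ⟨U, hU⟩ := Option.ne_none_iff_exists'.1 hk
        obtain ⟨U', hU'⟩ := Option.ne_none_iff_exists'.1 hk'
        obtain ⟨b, hb, hbk, -⟩ := (builtCtx_eq_some (htr _ hi x).1).1 hU
        obtain ⟨b', hb', hbk', -⟩ := (builtCtx_eq_some (htr _ hj x).1).1 hU'
        -- Both axioms belong to `a`, where admissibility identifies them; one axiom lies above only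
        -- one premise.
        obtain rfl := (htr a ha x).1 ((mem_axPos_of_app hx).2 ⟨i, hb⟩)
          ((mem_axPos_of_app hx).2 ⟨j, hb'⟩) (hbk.trans hbk'.symm)
        exact eq_of_mem_axPos_concat hb hb'
      · intro y k U
        rw [← hJ]
        change builtCtx t A tr T a y k = some U ↔ _
        rw [builtCtx_eq_some (htr a ha y).1]
        constructor
        · rintro ⟨a', ha', hk, hU⟩
          obtain ⟨i, hi⟩ := (mem_axPos_of_app hx).1 ha'
          have hiA : a ++ [i] ∈ A := hA.of_prefix ht.toIsTerm hi.2.1 hi.1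
          exact ⟨i, _, trivialConstruction_of_mem hiA,
            (builtCtx_eq_some (htr _ hiA y).1).2 ⟨a', hi, hk, hU⟩⟩
        · rintro ⟨i, D, hD, hU⟩
          obtain ⟨hi, rfl⟩ := trivialConstruction_eq_some.1 hD
          obtain ⟨a', ha', hk, hU'⟩ := (builtCtx_eq_some (htr _ hi y).1).1 hU
          exact ⟨a', (mem_axPos_of_app hx).2 ⟨i, ha'⟩, hk, hU'⟩

theorem isDerivationOf_trivialConstruction (ht : Is001Term t) (hnf : IsNormalForm t)
    (hA : IsDSupport t A) (htr : AdmissibleTracks t A tr)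
    (hT : ∀ a ∈ fullPositions t A, IsType (T a)) :
    IsDerivationOf t (trivialConstruction t A tr T) :=
  ⟨isDerivation_trivialConstruction ht hnf hA htr hT, _,
    trivialConstruction_of_mem (hA.nil_mem ht.toIsTerm), rfl⟩

theorem isQuantitative_trivialConstruction (ht : IsTerm t) (htr : AdmissibleTracks t A tr) :
    IsQuantitative t (trivialConstruction t A tr T) := by
  intro a J h x k U
  obtain ⟨ha, rfl⟩ := trivialConstruction_eq_some.1 h
  rw [supp_trivialConstruction, builtCtx_eq_some (htr a ha x).1]
  refine exists_congr fun a' => and_congr_right fun ha' => ?_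
  constructor
  · rintro ⟨rfl, rfl⟩
    exact trivialConstruction_of_var ht htr ha'.1 ha'.2.2.1
  · exact fun h' => (var_of_trivialConstruction_eq_ax ht htr h').2.2

end Built

/-! ## Derivations of a given term -/

section Derivation

variable {V X : Type*} {t : LTree (TermSym V)} {P : LTree (Judgment V X)}

theorem mem_supp_iff_exists {σ : Type*} {T : LTree σ} {a : List ℕ} :
    a ∈ supp T ↔ ∃ s, T a = some s :=
  Option.ne_none_iff_exists'

theorem AxRule.label {a : List ℕ} {J : Judgment V X} (h : AxRule P a J) :
    ∃ x, J.subj [] = some (.var x) := by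
  obtain ⟨x, k, T, -, rfl, -⟩ := h
  exact ⟨x, rfl⟩

theorem AbsRule.label {a : List ℕ} {J : Judgment V X} (h : AbsRule P a J) :
    ∃ x, J.subj [] = some (.lam x) := by
  obtain ⟨x, J₀, -, -, rfl⟩ := h
  exact ⟨x, rfl⟩

theorem AppRule.label {a : List ℕ} {J : Judgment V X} (h : AppRule P a J) :
    J.subj [] = some .app := by
  obtain ⟨u, J₁, -, -, e, -⟩ := h
  rw [e]
  rfl

theorem IsDerivation.axRule_of_label (h : IsDerivation P) {a : List ℕ} {J : Judgment V X}
    (ha : P a = some J) {x : V} (hx : J.subj [] = some (.var x)) : AxRule P a J := by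
  rcases h.rule a J ha with h | h | h
  · exact h
  · obtain ⟨y, hy⟩ := h.label
    simp [hx] at hy
  · have := h.label
    simp [hx] at this

theorem IsDerivation.absRule_of_label (h : IsDerivation P) {a : List ℕ} {J : Judgment V X}
    (ha : P a = some J) {x : V} (hx : J.subj [] = some (.lam x)) : AbsRule P a J := by
  rcases h.rule a J ha with h | h | h
  · obtain ⟨y, hy⟩ := h.label
    simp [hx] at hy
  · exact h
  · have := h.label
    simp [hx] at this

theorem IsDerivation.appRule_of_label (h : IsDerivation P) {a : List ℕ} {J : Judgment V X}
    (ha : P a = some J) (hx : J.subj [] = some .app) : AppRule P a J := by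
  rcases h.rule a J ha with h | h | h
  · obtain ⟨y, hy⟩ := h.label
    simp [hx] at hy
  · obtain ⟨y, hy⟩ := h.label
    simp [hx] at hy
  · exact h

/-- All argument premises of an application share one subject, which is why argument tracks collapse
to 2. -/
theorem IsDerivationOf.subj_eq (h : IsDerivationOf t P) {a : List ℕ} {J : Judgment V X}
    (ha : P a = some J) : J.subj = subtree t (collapse a) := by
  induction a using List.reverseRecOn generalizing J with
  | nil =>
    obtain ⟨J', hJ', rfl⟩ := h.2
    rw [ha, Option.some_inj] at hJ'
    rw [hJ']
    rfl
  | append_singleton a k ih =>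
    have hne : P a ≠ none := fun h' => by simp [h.1.outside _ k h'] at ha
    obtain ⟨J', hJ'⟩ := Option.ne_none_iff_exists'.1 hne
    have e := ih hJ'
    rw [collapse_append, ← subtree_subtree, ← e]
    rcases h.1.rule a J' hJ' with ⟨x, l, T, -, rfl, hn⟩ | ⟨x, J₀, h0, hn, rfl⟩ |
      ⟨u, J₁, h0, h1, hs, hu, -⟩
    · simp [hn] at ha
    · by_cases hk : k = 0
      · subst hk
        rw [h0, Option.some_inj] at ha
        rw [ha]
        rfl
      · simp [hn k hk] at ha
    · rw [hs]
      match k with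
      | 0 => simp [h0] at ha
      | 1 =>
        rw [h1, Option.some_inj] at ha
        rw [ha]
        rfl
      | k + 2 =>
        rw [hu _ J (by omega) ha]
        simp only [collapse, List.map_cons, List.map_nil]
        rw [show min (k + 2) 2 = 2 by omega]
        rfl

theorem IsDerivationOf.label_eq (h : IsDerivationOf t P) {a : List ℕ} {J : Judgment V X}
    (ha : P a = some J) : J.subj [] = t (collapse a) := by
  simp [h.subj_eq ha, subtree]

/-- Premises on tracks 0 and 1 are mandatory in the rules; only argument premises may be missing. -/
theorem IsDerivationOf.mem_of_append (h : IsDerivationOf t P) (ht : IsTerm t) {a c : List ℕ}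
    (hc : ∀ k ∈ c, k < 2) (ha : a ∈ supp P) (hac : t (collapse (a ++ c)) ≠ none) :
    a ++ c ∈ supp P := by
  induction c generalizing a with
  | nil => simpa using ha
  | cons k c ih =>
    rw [List.append_cons] at *
    refine ih (fun j hj => hc j (by simp [hj])) ?_ hac
    have hk := hc k (by simp)
    rw [collapse_append] at hac
    obtain ⟨J, hJ⟩ := mem_supp_iff_exists.1 ha
    have hl := h.label_eq hJ
    rcases ht.of_collapse_child (ht.ne_none_of_append _ hac) with ⟨x, hx, rfl⟩ | ⟨hx, hk'⟩
    · obtain ⟨y, J₀, h0, -⟩ := h.1.absRule_of_label hJ (hl.trans hx)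
      exact mem_supp_iff_exists.2 ⟨_, h0⟩
    · obtain rfl : k = 1 := by omega
      obtain ⟨u, J₁, -, h1, -⟩ := h.1.appRule_of_label hJ (hl.trans hx)
      exact mem_supp_iff_exists.2 ⟨_, h1⟩

theorem IsDerivation.mem_of_prefix (h : IsDerivation P) {a b : List ℕ} (hab : a <+: b)
    (hb : b ∈ supp P) : a ∈ supp P := by
  obtain ⟨c, rfl⟩ := hab
  induction c using List.reverseRecOn with
  | nil => simpa using hb
  | append_singleton c k ih =>
    rw [← List.append_assoc] at hb
    exact ih fun h' => hb (h.outside _ _ h')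

theorem IsDerivationOf.isDSupport (h : IsDerivationOf t P) (ht : IsTerm t) :
    IsDSupport t (supp P) where
  nonempty := ⟨[], h.1.root⟩
  sub a ha := by
    obtain ⟨J, hJ⟩ := mem_supp_iff_exists.1 ha
    have := (h.1.valid a J hJ).subj.root
    rwa [h.label_eq hJ] at this
  down a a' ha' ha := by
    rintro ⟨a₀, ⟨c, rfl⟩, h', hd, -⟩
    refine h.mem_of_append ht (fun k hk => ?_) (h.1.mem_of_prefix h' ha') ha
    have : c.countP (fun k => decide (2 ≤ k)) = 0 := by simpa [appDepth] using hd
    simpa using List.countP_eq_zero.1 this k hk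

/-! ### Recovering a quantitative derivation from its axiom tracks and full positions -/

theorem IsDerivationOf.exists_ax (h : IsDerivationOf t P) {a : List ℕ} (ha : a ∈ supp P) {x : V}
    (hx : t (collapse a) = some (.var x)) :
    ∃ k U, 2 ≤ k ∧ P a = some (Judgment.ax x k U) := by
  obtain ⟨J, hJ⟩ := mem_supp_iff_exists.1 ha
  have hl := (h.label_eq hJ).trans hx
  obtain ⟨y, k, U, hk, rfl, -⟩ := h.1.axRule_of_label hJ hl
  obtain rfl : y = x := by simpa [Judgment.ax, termVar, leaf] using hl
  exact ⟨k, U, hk, hJ⟩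

/-- Two axioms of `x` with the same track are followed upwards from `a`. If they parted at an
application, quantitativity would put this track in the contexts of two premises, against their
disjointness. -/
theorem IsDerivationOf.admissibleTracks (h : IsDerivationOf t P) (hq : IsQuantitative t P)
    (ht : IsTerm t) {tr : List ℕ → ℕ}
    (htr : ∀ a x k U, P a = some (Judgment.ax x k U) → tr a = k) :
    AdmissibleTracks t (supp P) tr := by
  -- `n` bounds the distance from `a` to `a₁`; at distance 0 the subterm at `a` is a variable and
  -- has no other axiom.
  have key : ∀ n, ∀ a x a₁ a₂, a₁.length ≤ a.length + n → a₁ ∈ axPos t (supp P) a x →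
      a₂ ∈ axPos t (supp P) a x → tr a₁ = tr a₂ → a₁ = a₂ := by
    intro n
    induction n with
    | zero =>
      intro a x a₁ a₂ hn h₁ h₂ _
      obtain rfl := h₁.2.1.eq_of_length_le hn
      exact (((mem_axPos_of_var ht h₁.1 h₁.2.2.1).1 h₂).1).symm
    | succ n ih =>
      intro a x a₁ a₂ hn h₁ h₂ e
      have ha := h.1.mem_of_prefix h₁.2.1 h₁.1
      obtain ⟨J, hJ⟩ := mem_supp_iff_exists.1 ha
      have hl := h.label_eq hJ
      rcases hx : t (collapse a) with _ | (y | y | _)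
      · exact absurd hx ((h.isDSupport ht).sub a ha)
      · rw [((mem_axPos_of_var ht ha hx).1 h₁).1, ((mem_axPos_of_var ht ha hx).1 h₂).1]
      · exact ih (a ++ [0]) x a₁ a₂ (by simp; omega) ((mem_axPos_of_lam ht hx).1 h₁).2
          ((mem_axPos_of_lam ht hx).1 h₂).2 e
      · obtain ⟨i, hi⟩ := (mem_axPos_of_app hx).1 h₁
        obtain ⟨j, hj⟩ := (mem_axPos_of_app hx).1 h₂
        obtain ⟨k₁, U₁, -, e₁⟩ := h.exists_ax h₁.1 h₁.2.2.1
        obtain ⟨k₂, U₂, -, e₂⟩ := h.exists_ax h₂.1 h₂.2.2.1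
        obtain rfl : k₁ = k₂ := by rw [← htr _ _ _ _ e₁, ← htr _ _ _ _ e₂, e]
        obtain ⟨D, hD⟩ := mem_supp_iff_exists.1 (h.1.mem_of_prefix hi.2.1 hi.1)
        obtain ⟨D', hD'⟩ := mem_supp_iff_exists.1 (h.1.mem_of_prefix hj.2.1 hj.1)
        have c₁ := (hq _ _ hD x k₁ U₁).2 ⟨a₁, hi, e₁⟩
        have c₂ := (hq _ _ hD' x k₁ U₂).2 ⟨a₂, hj, e₂⟩
        obtain ⟨u, J₁, -, -, -, -, -, hdis, -⟩ := h.1.appRule_of_label hJ (hl.trans hx)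
        obtain rfl := hdis i j D D' x k₁ hD hD' (by simp [c₁]) (by simp [c₂])
        exact ih (a ++ [i]) x a₁ a₂ (by simp; omega) hi hj e
  intro a _ x
  refine ⟨fun a₁ h₁ a₂ h₂ e => key a₁.length a x a₁ a₂ (by omega) h₁ h₂ e, fun a' ha' => ?_⟩
  obtain ⟨k, U, hk, e⟩ := h.exists_ax ha'.1 ha'.2.2.1
  rwa [htr _ _ _ _ e]

/-- Both families of types solve the same guarded system, with the same values at full positions. -/
theorem IsDerivationOf.builtType_eq_ty (h : IsDerivationOf t P) (hq : IsQuantitative t P)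
    (ht : Is001Term t) {tr : List ℕ → ℕ} {T : List ℕ → LTree (TySym X)}
    (htr : ∀ a x k U, P a = some (Judgment.ax x k U) → tr a = k)
    (hT : ∀ a J, a ∈ fullPositions t (supp P) → P a = some J → T a = J.ty)
    {a : List ℕ} {J : Judgment V X} (ha : P a = some J) :
    builtType t (supp P) tr T a = J.ty := by
  have hA := h.isDSupport ht.toIsTerm
  have hadm := h.admissibleTracks hq ht.toIsTerm htr
  -- One unfolding of the system: the two types at `a` agree, or both are arrows whose components
  -- are again paired types at nodes of `P`.
  have step : ∀ a J, P a = some J → builtType t (supp P) tr T a = J.ty ∨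
      ∃ F G b J', P b = some J' ∧ builtType t (supp P) tr T a =
        arrow F (builtType t (supp P) tr T b) ∧ J.ty = arrow G J'.ty ∧
        ∀ k, 2 ≤ k → (F k = none ∧ G k = none) ∨ ∃ b' J'', P b' = some J'' ∧
          F k = some (builtType t (supp P) tr T b') ∧ G k = some J''.ty := by
    intro a J ha
    have haA : a ∈ supp P := mem_supp_iff_exists.2 ⟨J, ha⟩
    rcases full_or_isAbsPos_or_concat_one t a with hf | ⟨x, hx⟩ | ⟨b, rfl, hb⟩
    · exact Or.inl ((builtType_of_full hf).trans (hT a J ⟨haA, hf⟩ ha))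
    · have hl := (h.label_eq ha).trans hx
      have h0A := hA.zero_mem ht.toIsTerm haA hx
      obtain ⟨y, J₀, h0, -, rfl⟩ := h.1.absRule_of_label ha hl
      obtain rfl : y = x := by simpa [termLam] using hl
      refine Or.inr ⟨_, _, _, J₀, h0, builtType_of_lam ht hx, rfl, fun k hk => ?_⟩
      rcases hG : J₀.ctx y k with _ | U
      · refine Or.inl ⟨?_, rfl⟩
        -- A track of the built context comes from an axiom, so quantitativity of `P` puts it in
        -- `J₀.ctx y` as well.
        by_contra hF
        obtain ⟨U, hU⟩ := Option.ne_none_iff_exists'.1 hF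
        obtain ⟨a', ha', rfl, -⟩ := (builtCtx_eq_some (hadm _ h0A y).1).1 hU
        obtain ⟨l, W, -, e⟩ := h.exists_ax ha'.1 ha'.2.2.1
        rw [htr _ _ _ _ e] at hG
        simp [(hq _ _ h0 y l W).2 ⟨a', ha', e⟩] at hG
      · obtain ⟨a', ha', e⟩ := (hq _ _ h0 y k U).1 hG
        exact Or.inr ⟨a', _, e, (builtCtx_eq_some (hadm _ h0A y).1).2
          ⟨a', ha', htr _ _ _ _ e, rfl⟩, rfl⟩
    · have happ := hA.app_of_one_mem ht.toIsTerm haA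
      obtain ⟨J', hJ'⟩ := mem_supp_iff_exists.1 (hA.of_concat ht.toIsTerm haA)
      obtain ⟨u, J₁, -, h1, -, -, hty, -⟩ :=
        h.1.appRule_of_label hJ' ((h.label_eq hJ').trans happ)
      rw [ha, Option.some_inj] at h1
      subst h1
      refine Or.inr ⟨_, _, b, J', hJ', builtType_concat_one (not_isAbsPos_of_app happ) hb, hty,
        fun k hk => ?_⟩
      rcases hD : P (b ++ [k]) with _ | D
      · simp [argTypes, hD, supp]
      · exact Or.inr ⟨_, D, hD, by simp [hk, supp, hD], by simp [argTypes, hD, hk]⟩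
  -- Each unfolding consumes one track of `c`, so induction on `c`, for all nodes at once, replaces
  -- coinduction.
  funext c
  induction c generalizing a J with
  | nil =>
    rcases step a J ha with e | ⟨F, G, b, J', -, e, e', -⟩
    · rw [e]
    · simp [e, e']
  | cons k c ih =>
    rcases step a J ha with e | ⟨F, G, b, J', hb, e, e', hFG⟩
    · rw [e]
    · rw [e, e']
      match k with
      | 0 => rfl
      | 1 => exact ih hb
      | k + 2 =>
        rcases hFG (k + 2) (by omega) with ⟨hF, hG⟩ | ⟨b', J'', hb', hF, hG⟩
        · simp [arrow, hF, hG]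
        · simpa [arrow, hF, hG] using ih hb'

theorem IsDerivationOf.trivialConstruction_eq (h : IsDerivationOf t P) (hq : IsQuantitative t P)
    (ht : Is001Term t) {tr : List ℕ → ℕ} {T : List ℕ → LTree (TySym X)}
    (htr : ∀ a x k U, P a = some (Judgment.ax x k U) → tr a = k)
    (hT : ∀ a J, a ∈ fullPositions t (supp P) → P a = some J → T a = J.ty) :
    trivialConstruction t (supp P) tr T = P := by
  have hadm := h.admissibleTracks hq ht.toIsTerm htr
  funext a
  rcases ha : P a with _ | J
  · rw [trivialConstruction_eq_none]
    exact fun h' => h' ha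
  · have haA : a ∈ supp P := mem_supp_iff_exists.2 ⟨J, ha⟩
    rw [trivialConstruction_of_mem haA, Option.some_inj]
    refine Judgment.ext ?_ (h.subj_eq ha).symm (h.builtType_eq_ty hq ht htr hT ha)
    funext x
    refine builtCtx_ext (hadm a haA x).1 fun k U => ?_
    rw [hq _ _ ha x k U]
    refine exists_congr fun a' => and_congr_right fun ha' => ?_
    obtain ⟨l, W, -, e⟩ := h.exists_ax ha'.1 ha'.2.2.1
    rw [h.builtType_eq_ty hq ht htr hT e, htr _ _ _ _ e]
    constructor
    · intro e'
      rw [e, Option.some_inj] at e'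
      have := (Judgment.ax_ctx_eq_some (x := x) (k := k) (U := U)).2 ⟨rfl, rfl, rfl⟩
      rw [← e', Judgment.ax_ctx_eq_some] at this
      exact ⟨this.2.1.symm, this.2.2⟩
    · rintro ⟨rfl, rfl⟩
      exact e

/-- With these tracks `P` is itself a trivial construction, so it can be compared with the one for
another choice of tracks. The value 0 off the axioms plays no role. -/
theorem exists_axiom_tracks (P : LTree (Judgment V X)) :
    ∃ tr : List ℕ → ℕ, ∀ a x k U, P a = some (Judgment.ax x k U) → tr a = k := by
  classical
  refine ⟨fun a => if h : ∃ k x U, P a = some (Judgment.ax x k U) then h.choose else 0, ?_⟩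
  intro a x k U ha
  have h : ∃ k x U, P a = some (Judgment.ax x k U) := ⟨k, x, U, ha⟩
  simp only [dif_pos h]
  obtain ⟨y, W, e⟩ := h.choose_spec
  replace e := Option.some_injective _ (ha.symm.trans e)
  have := (Judgment.ax_ctx_eq_some (x := x) (k := k) (U := U)).2 ⟨rfl, rfl, rfl⟩
  rw [e, Judgment.ax_ctx_eq_some] at this
  exact this.2.1.symm

end Derivation

/-! ## Changing the axiom tracks -/

section Relabel

variable {V X : Type*} {t : LTree (TermSym V)} {A : Set (List ℕ)} {tr tr' : List ℕ → ℕ}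
  {T : List ℕ → LTree (TySym X)}

open Classical in
/-- The axiom position of `x` above `a` whose track is `k`. -/
noncomputable def axAt (t : LTree (TermSym V)) (A : Set (List ℕ)) (tr : List ℕ → ℕ)
    (a : List ℕ) (x : V) (k : ℕ) : List ℕ :=
  if h : ∃ a' ∈ axPos t A a x, tr a' = k then h.choose else []

theorem axAt_eq {a a' : List ℕ} {x : V} (h : Set.InjOn tr (axPos t A a x))
    (ha' : a' ∈ axPos t A a x) : axAt t A tr a x (tr a') = a' := by
  have hk : ∃ b ∈ axPos t A a x, tr b = tr a' := ⟨a', ha', rfl⟩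
  rw [axAt, dif_pos hk]
  exact h hk.choose_spec.1 ha' hk.choose_spec.2

open Classical in
/-- The bijection from the type at `a` built with the axiom tracks `tr` onto the type at `a` built
with the axiom tracks `tr'`. -/
noncomputable def relabel (t : LTree (TermSym V)) (A : Set (List ℕ)) (tr tr' : List ℕ → ℕ) :
    List ℕ → List ℕ → List ℕ
  | _, [] => []
  | a, k :: c =>
    if fullPos t a = a then k :: c
    else match t (collapse a) with
      | some (.lam x) =>
        if k = 1 then 1 :: relabel t A tr tr' (a ++ [0]) c
        else tr' (axAt t A tr (a ++ [0]) x k) ::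
          relabel t A tr tr' (axAt t A tr (a ++ [0]) x k) c
      | _ =>
        -- Here `a` is neither full nor an abstraction, so it ends with 1 and `a.dropLast` is the
        -- application node. The recursion is on the position in the type, since `a` may grow or
        -- shrink.
        if k = 1 then 1 :: relabel t A tr tr' a.dropLast c
        else k :: relabel t A tr tr' (a.dropLast ++ [k]) c

/-- The bijection between the sequence types of `x` at `a`. -/
noncomputable def relabelCtx (t : LTree (TermSym V)) (A : Set (List ℕ)) (tr tr' : List ℕ → ℕ)
    (a : List ℕ) (x : V) : List ℕ → List ℕ
  | [] => []
  | k :: c => tr' (axAt t A tr a x k) :: relabel t A tr tr' (axAt t A tr a x k) c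

@[simp] theorem relabel_nil (a : List ℕ) : relabel t A tr tr' a [] = [] := by
  simp [relabel]

theorem relabel_of_full {a : List ℕ} (h : fullPos t a = a) (c : List ℕ) :
    relabel t A tr tr' a c = c := by
  cases c <;> simp [relabel, h]

theorem relabel_lam_one (ht : Is001Term t) {a : List ℕ} {x : V}
    (h : t (collapse a) = some (.lam x)) (c : List ℕ) :
    relabel t A tr tr' a (1 :: c) = 1 :: relabel t A tr tr' (a ++ [0]) c := by
  have hf : fullPos t a ≠ a := fun hf => not_isAbsPos_of_full ht hf ⟨x, h⟩
  simp [relabel, hf, h]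

theorem relabel_lam_arg (ht : Is001Term t) {a : List ℕ} {x : V}
    (h : t (collapse a) = some (.lam x)) {k : ℕ} (hk : 2 ≤ k) (c : List ℕ) :
    relabel t A tr tr' a (k :: c) = relabelCtx t A tr tr' (a ++ [0]) x (k :: c) := by
  have hf : fullPos t a ≠ a := fun hf => not_isAbsPos_of_full ht hf ⟨x, h⟩
  have hk' : k ≠ 1 := by omega
  simp [relabel, relabelCtx, hf, h, hk']

theorem relabel_concat_one_one {b : List ℕ} (h : ¬ IsAbsPos t (b ++ [1])) (c : List ℕ) :
    relabel t A tr tr' (b ++ [1]) (1 :: c) = 1 :: relabel t A tr tr' b c := by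
  rw [relabel, if_neg (fullPos_concat_one_ne h)]
  split
  · rename_i x hx
    exact absurd ⟨x, hx⟩ h
  · simp

theorem relabel_concat_one_arg {b : List ℕ} (h : ¬ IsAbsPos t (b ++ [1])) {k : ℕ} (hk : 2 ≤ k)
    (c : List ℕ) :
    relabel t A tr tr' (b ++ [1]) (k :: c) = k :: relabel t A tr tr' (b ++ [k]) c := by
  have hk' : k ≠ 1 := by omega
  rw [relabel, if_neg (fullPos_concat_one_ne h)]
  split
  · rename_i x hx
    exact absurd ⟨x, hx⟩ h
  · simp [hk']

theorem relabelCtx_cons {a a' : List ℕ} {x : V} (h : Set.InjOn tr (axPos t A a x))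
    (ha' : a' ∈ axPos t A a x) (c : List ℕ) :
    relabelCtx t A tr tr' a x (tr a' :: c) = tr' a' :: relabel t A tr tr' a' c := by
  rw [relabelCtx, axAt_eq h ha']

theorem mem_supp_forest_builtCtx {a : List ℕ} {x : V} (h : Set.InjOn tr (axPos t A a x))
    {d : List ℕ} : d ∈ supp (builtCtx t A tr T a x).forest ↔
      ∃ a' ∈ axPos t A a x, ∃ c ∈ supp (builtType t A tr T a'), d = tr a' :: c := by
  cases d with
  | nil => simp [supp, Seq.forest]
  | cons k c =>
    simp only [mem_supp_iff_exists, Seq.forest, Option.bind_eq_some_iff, List.cons.injEq,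
      builtCtx_eq_some h]
    constructor
    · rintro ⟨s, U, ⟨a', ha', rfl, rfl⟩, hc⟩
      exact ⟨a', ha', c, ⟨s, hc⟩, rfl, rfl⟩
    · rintro ⟨a', ha', c, ⟨s, hc⟩, rfl, rfl⟩
      exact ⟨s, _, ⟨a', ha', rfl, rfl⟩, hc⟩

theorem forest_builtCtx_cons {a a' : List ℕ} {x : V} (h : Set.InjOn tr (axPos t A a x))
    (ha' : a' ∈ axPos t A a x) (c : List ℕ) :
    (builtCtx t A tr T a x).forest (tr a' :: c) = builtType t A tr T a' c := by
  simp [Seq.forest, (builtCtx_eq_some h).2 ⟨a', ha', rfl, rfl⟩]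

theorem builtType_lam_arg (ht : Is001Term t) {a : List ℕ} {x : V}
    (h : t (collapse a) = some (.lam x)) {k : ℕ} (hk : 2 ≤ k) (c : List ℕ) :
    builtType t A tr T a (k :: c) = (builtCtx t A tr T (a ++ [0]) x).forest (k :: c) := by
  rw [builtType_of_lam ht h, arrow_of_two_le _ _ hk]
  rfl

theorem builtType_concat_one_arg {b : List ℕ} (h : ¬ IsAbsPos t b) (h' : ¬ IsAbsPos t (b ++ [1]))
    {k : ℕ} (hk : 2 ≤ k) (hA : b ++ [k] ∈ A) (c : List ℕ) :
    builtType t A tr T (b ++ [1]) (k :: c) = builtType t A tr T (b ++ [k]) c := by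
  rw [builtType_concat_one h h', arrow_of_two_le _ _ hk]
  simp [hk, hA]

/-- Induction on the positions of the types of the trivial construction. -/
theorem builtType_induction (ht : Is001Term t) (hA : IsDSupport t A)
    (htr : AdmissibleTracks t A tr) (T : List ℕ → LTree (TySym X)) {p : List ℕ → List ℕ → Prop}
    (nil : ∀ a ∈ A, builtType t A tr T a [] ≠ none → p a [])
    (full : ∀ a ∈ A, fullPos t a = a → ∀ c, T a c ≠ none → p a c)
    (lam_one : ∀ a ∈ A, ∀ x, t (collapse a) = some (.lam x) → ∀ c, p (a ++ [0]) c → p a (1 :: c))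
    (lam_arg : ∀ a ∈ A, ∀ x, t (collapse a) = some (.lam x) → ∀ a' ∈ axPos t A (a ++ [0]) x,
      ∀ c, p a' c → p a (tr a' :: c))
    (one_one : ∀ b, b ++ [1] ∈ A → t (collapse b) = some .app → ¬ IsAbsPos t (b ++ [1]) →
      ∀ c, p b c → p (b ++ [1]) (1 :: c))
    (one_arg : ∀ b, b ++ [1] ∈ A → t (collapse b) = some .app → ¬ IsAbsPos t (b ++ [1]) →
      ∀ k, 2 ≤ k → b ++ [k] ∈ A → ∀ c, p (b ++ [k]) c → p (b ++ [1]) (k :: c))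
    {a : List ℕ} (ha : a ∈ A) {c : List ℕ} (hc : c ∈ supp (builtType t A tr T a)) : p a c := by
  change builtType t A tr T a c ≠ none at hc
  induction c generalizing a with
  | nil => exact nil a ha hc
  | cons k c ih =>
    rcases full_or_isAbsPos_or_concat_one t a with hf | ⟨x, hx⟩ | ⟨b, rfl, hb⟩
    · exact full a ha hf _ (by rwa [builtType_of_full hf] at hc)
    · have h0 := hA.zero_mem ht.toIsTerm ha hx
      have e := builtType_of_lam (A := A) (tr := tr) (T := T) ht hx
      match k with
      | 0 => simp [e] at hc
      | 1 => exact lam_one a ha x hx c (ih h0 (by simpa [e] using hc))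
      | k + 2 =>
        rw [builtType_lam_arg ht hx (by omega)] at hc
        obtain ⟨a', ha', c', hc', e'⟩ := (mem_supp_forest_builtCtx (htr _ h0 x).1).1 hc
        simp only [List.cons.injEq] at e'
        obtain ⟨e', rfl⟩ := e'
        rw [e']
        exact lam_arg a ha x hx a' ha' _ (ih ha'.1 hc')
    · have happ := hA.app_of_one_mem ht.toIsTerm ha
      have e := builtType_concat_one (A := A) (tr := tr) (T := T) (not_isAbsPos_of_app happ) hb
      match k with
      | 0 => simp [e] at hc
      | 1 =>
        exact one_one b ha happ hb c (ih (hA.of_concat ht.toIsTerm ha) (by simpa [e] using hc))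
      | k + 2 =>
        have hk : b ++ [k + 2] ∈ A := by
          by_contra hk
          simp [e, arrow, hk] at hc
        rw [builtType_concat_one_arg (not_isAbsPos_of_app happ) hb (by omega) hk] at hc
        exact one_arg b ha happ hb _ (by omega) hk c (ih hk hc)

theorem builtType_nil (ht : Is001Term t) (hA : IsDSupport t A) {a : List ℕ} (ha : a ∈ A) :
    builtType t A tr' T a [] = builtType t A tr T a [] := by
  rcases full_or_isAbsPos_or_concat_one t a with hf | ⟨x, hx⟩ | ⟨b, rfl, hb⟩
  · rw [builtType_of_full hf, builtType_of_full hf]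
  · rw [builtType_of_lam ht hx, builtType_of_lam ht hx, arrow_nil, arrow_nil]
  · have h := not_isAbsPos_of_app (hA.app_of_one_mem ht.toIsTerm ha)
    rw [builtType_concat_one h hb, builtType_concat_one h hb, arrow_nil, arrow_nil]

/-- Both claims follow the recursion of `relabel`. The statement is symmetric in `tr` and `tr'`, so
it also yields the other inverse, hence bijectivity. -/
theorem builtType_relabel (ht : Is001Term t) (hA : IsDSupport t A)
    (htr : AdmissibleTracks t A tr) (htr' : AdmissibleTracks t A tr') {a : List ℕ} (ha : a ∈ A)
    {c : List ℕ} (hc : c ∈ supp (builtType t A tr T a)) :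
    builtType t A tr' T a (relabel t A tr tr' a c) = builtType t A tr T a c ∧
      relabel t A tr' tr a (relabel t A tr tr' a c) = c := by
  refine builtType_induction (p := fun a c =>
    builtType t A tr' T a (relabel t A tr tr' a c) = builtType t A tr T a c ∧
      relabel t A tr' tr a (relabel t A tr tr' a c) = c) ht hA htr T ?_ ?_ ?_ ?_ ?_ ?_ ha hc
  · exact fun a ha _ => by simp [builtType_nil (tr := tr) (tr' := tr') ht hA ha]
  · exact fun a _ h c _ => by simp [relabel_of_full h, builtType_of_full h]
  · rintro a ha x hx c ⟨h1, h2⟩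
    rw [relabel_lam_one ht hx, relabel_lam_one ht hx, h2, builtType_of_lam ht hx,
      builtType_of_lam ht hx]
    exact ⟨h1, rfl⟩
  · rintro a ha x hx a' ha' c ⟨h1, h2⟩
    have h0 := hA.zero_mem ht.toIsTerm ha hx
    have k2 := (htr _ h0 x).2 a' ha'
    have k2' := (htr' _ h0 x).2 a' ha'
    rw [relabel_lam_arg ht hx k2, relabelCtx_cons (htr _ h0 x).1 ha', builtType_lam_arg ht hx k2',
      builtType_lam_arg ht hx k2, forest_builtCtx_cons (htr _ h0 x).1 ha',
      forest_builtCtx_cons (htr' _ h0 x).1 ha', relabel_lam_arg ht hx k2',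
      relabelCtx_cons (htr' _ h0 x).1 ha', h2]
    exact ⟨h1, rfl⟩
  · rintro b - happ h' c ⟨h1, h2⟩
    have h := not_isAbsPos_of_app happ
    rw [relabel_concat_one_one h', relabel_concat_one_one h', h2, builtType_concat_one h h',
      builtType_concat_one h h']
    exact ⟨h1, rfl⟩
  · rintro b - happ h' k hk hkA c ⟨h1, h2⟩
    have h := not_isAbsPos_of_app happ
    rw [relabel_concat_one_arg h' hk, relabel_concat_one_arg h' hk, h2,
      builtType_concat_one_arg h h' hk hkA, builtType_concat_one_arg h h' hk hkA]
    exact ⟨h1, rfl⟩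

theorem relabel_step (ht : Is001Term t) (hA : IsDSupport t A) (htr : AdmissibleTracks t A tr)
    (htr' : AdmissibleTracks t A tr') {a : List ℕ} (ha : a ∈ A) {c : List ℕ} {k : ℕ}
    (hc : c ++ [k] ∈ supp (builtType t A tr T a)) :
    ∃ k', relabel t A tr tr' a (c ++ [k]) = relabel t A tr tr' a c ++ [k'] ∧
      min k' 2 = min k 2 := by
  -- If the first track `j` is sent to `j'` and the rest is relabelled at `a'`, the property for the
  -- rest extends to the whole. The new case is the edge `j` itself, leaving the root.
  have aux : ∀ {a a' : List ℕ} {j j' : ℕ} {d : List ℕ},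
      (∀ e, relabel t A tr tr' a (j :: e) = j' :: relabel t A tr tr' a' e) →
      min j' 2 = min j 2 →
      (∀ c k, d = c ++ [k] → ∃ k', relabel t A tr tr' a' (c ++ [k]) =
        relabel t A tr tr' a' c ++ [k'] ∧ min k' 2 = min k 2) →
      ∀ c k, j :: d = c ++ [k] → ∃ k', relabel t A tr tr' a (c ++ [k]) =
        relabel t A tr tr' a c ++ [k'] ∧ min k' 2 = min k 2 := by
    intro a a' j j' d hj hm h c k e
    rcases c with _ | ⟨i, c⟩
    · simp only [List.nil_append, List.cons.injEq] at e
      obtain ⟨rfl, rfl⟩ := e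
      exact ⟨j', by simp [hj], hm⟩
    · simp only [List.cons_append, List.cons.injEq] at e
      obtain ⟨rfl, e⟩ := e
      obtain ⟨k', h1, h2⟩ := h c k e
      exact ⟨k', by simp [hj, h1], h2⟩
  refine builtType_induction (p := fun a d => ∀ c k, d = c ++ [k] →
    ∃ k', relabel t A tr tr' a (c ++ [k]) = relabel t A tr tr' a c ++ [k'] ∧
      min k' 2 = min k 2) ht hA htr T ?_ ?_ ?_ ?_ ?_ ?_ ha hc c k rfl
  · intro a _ _ c k e
    simp at e
  · exact fun a _ h _ _ c k _ => ⟨k, by simp [relabel_of_full h], rfl⟩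
  · exact fun a _ x hx c h => aux (relabel_lam_one ht hx) rfl h
  · intro a ha x hx a' ha' c h
    have h0 := hA.zero_mem ht.toIsTerm ha hx
    have k2 := (htr _ h0 x).2 a' ha'
    have k2' := (htr' _ h0 x).2 a' ha'
    refine aux (j' := tr' a') (fun e => ?_) (by rw [min_eq_right k2, min_eq_right k2']) h
    rw [relabel_lam_arg ht hx k2, relabelCtx_cons (htr _ h0 x).1 ha']
  · exact fun b _ _ h' c h => aux (relabel_concat_one_one h') rfl h
  · exact fun b _ _ h' k hk _ c h => aux (relabel_concat_one_arg h' hk) rfl h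

/-! ### From relabelling to isomorphisms of derivations -/

theorem IsLabelledIso.of_inverse {σ : Type*} {T₁ T₂ : LTree σ} {φ ψ : List ℕ → List ℕ}
    (root : φ [] = []) (h : ∀ c ∈ supp T₁, T₂ (φ c) = T₁ c ∧ ψ (φ c) = c)
    (h' : ∀ c ∈ supp T₂, T₁ (ψ c) = T₂ c ∧ φ (ψ c) = c)
    (step : ∀ a k, a ++ [k] ∈ supp T₁ → ∃ k', φ (a ++ [k]) = φ a ++ [k'] ∧ min k' 2 = min k 2) :
    IsLabelledIso T₁ T₂ φ where
  root := root
  bij := Set.InvOn.bijOn ⟨fun c hc => (h c hc).2, fun c hc => (h' c hc).2⟩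
    (fun c hc => by change T₂ (φ c) ≠ none; rw [(h c hc).1]; exact hc)
    (fun c hc => by change T₁ (ψ c) ≠ none; rw [(h' c hc).1]; exact hc)
  step := step
  label c hc := (h c hc).1

theorem isLabelledIso_relabel (ht : Is001Term t) (hA : IsDSupport t A)
    (htr : AdmissibleTracks t A tr) (htr' : AdmissibleTracks t A tr') {a : List ℕ} (ha : a ∈ A) :
    IsLabelledIso (builtType t A tr T a) (builtType t A tr' T a) (relabel t A tr tr' a) :=
  .of_inverse (relabel_nil a) (fun _ hc => builtType_relabel ht hA htr htr' ha hc)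
    (fun _ hc => builtType_relabel ht hA htr' htr ha hc)
    (fun _ _ hc => relabel_step ht hA htr htr' ha hc)

theorem isLabelledIso_relabelCtx (ht : Is001Term t) (hA : IsDSupport t A)
    (htr : AdmissibleTracks t A tr) (htr' : AdmissibleTracks t A tr') {a : List ℕ} (ha : a ∈ A)
    (x : V) :
    IsLabelledIso (builtCtx t A tr T a x).forest (builtCtx t A tr' T a x).forest
      (relabelCtx t A tr tr' a x) := by
  have key : ∀ {tr tr' : List ℕ → ℕ}, AdmissibleTracks t A tr → AdmissibleTracks t A tr' →
      ∀ c ∈ supp (builtCtx t A tr T a x).forest,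
        (builtCtx t A tr' T a x).forest (relabelCtx t A tr tr' a x c) =
          (builtCtx t A tr T a x).forest c ∧
        relabelCtx t A tr' tr a x (relabelCtx t A tr tr' a x c) = c := by
    intro tr tr' htr htr' d hd
    obtain ⟨a', ha', c, hc, rfl⟩ := (mem_supp_forest_builtCtx (htr a ha x).1).1 hd
    obtain ⟨h1, h2⟩ := builtType_relabel ht hA htr htr' ha'.1 hc
    rw [relabelCtx_cons (htr a ha x).1 ha', relabelCtx_cons (htr' a ha x).1 ha', h2,
      forest_builtCtx_cons (htr a ha x).1 ha', forest_builtCtx_cons (htr' a ha x).1 ha']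
    exact ⟨h1, rfl⟩
  refine .of_inverse rfl (key htr htr') (key htr' htr) fun d k hd => ?_
  obtain ⟨a', ha', c, hc, e⟩ := (mem_supp_forest_builtCtx (htr a ha x).1).1 hd
  rcases d with _ | ⟨j, d⟩
  · simp only [List.nil_append, List.cons.injEq] at e
    obtain ⟨rfl, rfl⟩ := e
    refine ⟨tr' a', ?_, by
      rw [min_eq_right ((htr a ha x).2 a' ha'), min_eq_right ((htr' a ha x).2 a' ha')]⟩
    rw [List.nil_append, relabelCtx_cons (htr a ha x).1 ha', relabel_nil]
    rfl
  · simp only [List.cons_append, List.cons.injEq] at e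
    obtain ⟨rfl, rfl⟩ := e
    obtain ⟨k', h1, h2⟩ := relabel_step ht hA htr htr' ha'.1 hc
    refine ⟨k', ?_, h2⟩
    rw [List.cons_append, relabelCtx_cons (htr a ha x).1 ha', relabelCtx_cons (htr a ha x).1 ha',
      h1]
    rfl

/-- Positions are fixed and only types and contexts are relabelled. Compatibility with the rules
amounts to the recursion equations of `relabel`; for applications they require a left premise that
is not an abstraction. -/
theorem isomorphic_trivialConstruction (ht : Is001Term t) (hnf : IsNormalForm t)
    (hA : IsDSupport t A) (htr : AdmissibleTracks t A tr) (htr' : AdmissibleTracks t A tr') :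
    Isomorphic (trivialConstruction t A tr T) (trivialConstruction t A tr' T) := by
  have label : ∀ {a : List ℕ} {s}, subtree t (collapse a) [] = some s →
      t (collapse a) = some s := fun {a s} h => by simpa [subtree] using h
  refine ⟨id, relabel t A tr tr', relabelCtx t A tr tr', ?_, ?_, ?_, ?_, ?_, ?_, ?_, ?_, ?_⟩
  · simp only [supp_trivialConstruction]
    exact ⟨rfl, Set.bijOn_id A, fun a k _ => ⟨k, rfl, rfl⟩⟩
  · intro a J₁ J₂ h₁ h₂
    obtain ⟨ha, rfl⟩ := trivialConstruction_eq_some.1 h₁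
    obtain ⟨-, rfl⟩ := trivialConstruction_eq_some.1 h₂
    exact ⟨rfl, isLabelledIso_relabel ht hA htr htr' ha,
      isLabelledIso_relabelCtx ht hA htr htr' ha⟩
  · intro a x k U h c hc
    obtain ⟨ha, hx, rfl, -⟩ := var_of_trivialConstruction_eq_ax ht.toIsTerm htr h
    rw [relabelCtx_cons (htr a ha x).1 ((mem_axPos_of_var ht.toIsTerm ha hx).2 ⟨rfl, rfl⟩)]
    rfl
  · intro a J x h hx c _
    obtain ⟨ha, rfl⟩ := trivialConstruction_eq_some.1 h
    exact relabel_lam_one ht (label hx) c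
  · intro a J x h hx k c hk _
    obtain ⟨ha, rfl⟩ := trivialConstruction_eq_some.1 h
    exact relabel_lam_arg ht (label hx) hk c
  · intro a J x h hx y hy d hd
    obtain ⟨ha, rfl⟩ := trivialConstruction_eq_some.1 h
    obtain ⟨a', ha', c, hc, rfl⟩ := (mem_supp_forest_builtCtx (htr a ha y).1).1 hd
    rw [relabelCtx_cons (htr a ha y).1 ha',
      relabelCtx_cons (htr _ (hA.zero_mem ht.toIsTerm ha (label hx)) y).1
        ((mem_axPos_of_lam ht.toIsTerm (label hx)).1 ha').2]
  · intro a J h hx c _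
    obtain ⟨ha, rfl⟩ := trivialConstruction_eq_some.1 h
    exact relabel_concat_one_one (hnf.not_isAbsPos_one (label hx)) c
  · intro a J h hx k D hk hD
    obtain ⟨ha, rfl⟩ := trivialConstruction_eq_some.1 h
    exact ⟨k, rfl, fun c _ => relabel_concat_one_arg (hnf.not_isAbsPos_one (label hx)) hk c⟩
  · intro a J h hx i D hD x d hd
    obtain ⟨ha, rfl⟩ := trivialConstruction_eq_some.1 h
    obtain ⟨hi, rfl⟩ := trivialConstruction_eq_some.1 hD
    obtain ⟨a', ha', c, hc, rfl⟩ := (mem_supp_forest_builtCtx (htr _ hi x).1).1 hd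
    rw [relabelCtx_cons (htr _ hi x).1 ha',
      relabelCtx_cons (htr a ha x).1 ((mem_axPos_of_app (label hx)).2 ⟨i, ha'⟩)]

end Relabel

end Rigid

theorem mainTheorem10 {V X : Type*} (t : LTree (TermSym V)) (ht : Is001Term t)
    (hnf : IsNormalForm t) :
    (∀ P : LTree (Judgment V X), IsDerivationOf t P → IsQuantitative t P →
      IsDSupport t (supp P) ∧
      ∀ T : List ℕ → LTree (TySym X),
        (∀ a J, a ∈ fullPositions t (supp P) → P a = some J → T a = J.ty) →
        (∀ tr : List ℕ → ℕ, (∀ a x k U, P a = some (Judgment.ax x k U) → tr a = k) →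
          AdmissibleTracks t (supp P) tr ∧ trivialConstruction t (supp P) tr T = P) ∧
        (∀ code : List ℕ → ℕ, Function.Injective code → (∀ a, 2 ≤ code a) →
          Isomorphic (trivialConstruction t (supp P) code T) P)) ∧
    (∀ (A : Set (List ℕ)) (tr : List ℕ → ℕ) (T : List ℕ → LTree (TySym X)),
      IsDSupport t A → AdmissibleTracks t A tr → (∀ a ∈ fullPositions t A, IsType (T a)) →
      IsDerivationOf t (trivialConstruction t A tr T) ∧
      IsQuantitative t (trivialConstruction t A tr T) ∧
      supp (trivialConstruction t A tr T) = A ∧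
      ∀ a J, a ∈ fullPositions t A → trivialConstruction t A tr T a = some J → J.ty = T a) := by
  refine ⟨fun P h hq => ?_, fun A tr T hA htr hT => ?_⟩
  · have hA := h.isDSupport ht.toIsTerm
    refine ⟨hA, fun T hT => ⟨fun tr htr => ?_, fun code hcode h2 => ?_⟩⟩
    · exact ⟨h.admissibleTracks hq ht.toIsTerm htr, h.trivialConstruction_eq hq ht htr hT⟩
    · obtain ⟨tr, htr⟩ := exists_axiom_tracks P
      -- Going from `code` to the tracks of `P` gives the isomorphism in the required direction, its
      -- target being `P`.
      have := isomorphic_trivialConstruction (T := T) ht hnf hA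
        (tr := code) (fun a _ x => ⟨hcode.injOn, fun a' _ => h2 a'⟩)
        (h.admissibleTracks hq ht.toIsTerm htr)
      rwa [h.trivialConstruction_eq hq ht htr hT] at this
  · refine ⟨isDerivationOf_trivialConstruction ht hnf hA htr hT,
      isQuantitative_trivialConstruction ht.toIsTerm htr, supp_trivialConstruction,
      fun a J ha h => ?_⟩
    obtain ⟨-, rfl⟩ := trivialConstruction_eq_some.1 h
    exact builtType_of_full ha.2
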